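/- **Types.** Simple types are generated by $\sigma ::= \mathsf N \mid \sigma\to\sigma$; every type has the form $\sigma_0,\dots,\sigma_{r-1}\to\mathsf N := \sigma_0\to\cdots\to\sigma_{r-1}\to\mathsf N$. The level is given by $\mathrm{lv}(\mathsf N)=0$, $\mathrm{lv}(\sigma\to\tau)=\max(\mathrm{lv}(\sigma)+1,\mathrm{lv}(\tau))$, and the width by $w(\mathsf N)=0$, $w(\sigma_0,\dots,\sigma_{r-1}\to\mathsf N)=\max(r,w(\sigma_0),\dots,w(\sigma_{r-1}))$. We say that $\sigma$ has sublevel $\le(k,l)$ if $(\mathrm{lv}(\sigma),w(\sigma))\le(k,l)$ in the lexicographic order (level first). The homogeneous types are $\rho_{0,l}=\mathsf N$ and $\rho_{k+1,l}=\rho_{k,l},\dots,\rho_{k,l}\to\mathsf N$ ($l$ arguments). **The language.** $\mathrm{PCF}^\Omega$ is the simply typed $\lambda$-calculus with constants $\widehat n:\mathsf N$ ($n\in\mathbb N$), $\mathit{suc},\mathit{pre}:\mathsf N\to\mathsf N$, $\mathit{ifzero}:\mathsf N\to\mathsf N\to\mathsf N\to\mathsf N$, $Y_\sigma:(\sigma\to\sigma)\to\sigma$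 for each type $\sigma$, and $C_f:\mathsf N\to\mathsf N$ for each partial function $f:\mathbb N\rightharpoonup\mathbb N$. Closed terms reduce by $(\lambda x.M)N\rightsquigarrow M[x\mapsto N]$, $\mathit{suc}\,\widehat n\rightsquigarrow\widehat{n+1}$, $\mathit{pre}\,\widehat{n+1}\rightsquigarrow\widehat n$, $\mathit{pre}\,\widehat 0\rightsquigarrow\widehat 0$, $\mathit{ifzero}\,\widehat 0\rightsquigarrow\lambda xy.x$, $\mathit{ifzero}\,\widehat{n+1}\rightsquigarrow\lambda xy.y$, $Y_\sigma M\rightsquigarrow M(Y_\sigma M)$, $C_f\,\widehat n\rightsquigarrow\widehat m$ if $f(n)=m$, and by closure under the evaluation contexts $[-]N$, $\mathit{suc}\,[-]$, $\mathit{pre}\,[-]$, $\mathit{ifzero}\,[-]$, $C_f\,[-]$. **The model.** Closed terms $M,M':\sigma$ are observationally equivalent if $C[M]\rightsquigarrow^*\widehat n\iff C[M']\rightsquigarrow^*\widehat n$ for all closed program contexts $C[-^\sigma]:\mathsf N$ of $\mathrm{PCF}^\Omega$ and all $n\in\mathbb N$. Let $\mathsf{SF}(\sigma)$ be the set of closed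 terms of type $\sigma$ modulo observational equivalence, with the application $\cdot$ induced by application of terms. In particular $\mathsf{SF}(\mathsf N)\cong\mathbb N\sqcup\{\bot\}$, with the order $\sqsubseteq$ in which $\bot$ lies below everything and distinct numbers are incomparable. Order $\mathsf{SF}(\sigma)$ by $x\preceq x'$ iff $h\cdot x\sqsubseteq h\cdot x'$ for all $h\in\mathsf{SF}(\sigma\to\mathsf N)$. For terms $M,M':\tau$ with a single free variable $z:\rho$, write $z\vdash M\succeq M'$ if the elements of $\mathsf{SF}(\rho\to\tau)$ denoted by $\lambda z.M$ and $\lambda z.M'$ satisfy $\lambda z.M'\preceq\lambda z.M$. A type $\rho$ is a *pseudo-retract within* $\mathsf{SF}$ of a finite product $\sigma_0\times\cdots\times\sigma_{m-1}$ if there are terms $z:\rho\vdash t_i:\sigma_i$ ($i<m$) and $x_0:\sigma_0,\dots,x_{m-1}:\sigma_{m-1}\vdash r:\rho$ of $\mathrm{PCF}^\Omega$ such that $z\vdash r[x_0\mapsto t_0,\dots,x_{m-1}\mapsto t_{m-1}]\succeq z$. **Theorem.** Let $k\ge 1$ and $l\ge 0$ be integers, and let $\sigma_0,\dots,\sigma_{m-1}$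 ($m\ge 0$) be types each of sublevel $\le(k,l)$. Then, within $\mathsf{SF}$, the type $\rho_{k,l+1}$ is not a pseudo-retract of the finite product $\sigma_0\times\cdots\times\sigma_{m-1}$. -/

import Mathlib

namespace PCF

/-- Simple types over the single base type of natural numbers. -/
inductive Ty : Type
  | nat : Ty
  | arr : Ty → Ty → Ty

namespace Ty

/-- The level of a type. -/
def level : Ty → ℕ
  | nat => 0
  | arr σ τ => max (σ.level + 1) τ.level

/-- The number `r` of arguments of a type `σ₀, …, σᵣ₋₁ → nat`. -/
def arity : Ty → ℕ
  | nat => 0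
  | arr _ τ => τ.arity + 1

/-- The width of a type. It is defined along the binary arrow; `width_arrows` below is the
recursion on `σ₀, …, σᵣ₋₁ → nat`. -/
def width : Ty → ℕ
  | nat => 0
  | arr σ τ => max (τ.arity + 1) (max σ.width τ.width)

/-- The type `σ₀, …, σᵣ₋₁ → nat` for a list `[σ₀, …, σᵣ₋₁]`. -/
def arrows (σs : List Ty) : Ty := σs.foldr arr nat

theorem arity_arrows (σs : List Ty) : (arrows σs).arity = σs.length := by
  induction σs with
  | nil => rfl
  | cons σ σs ih => simpa [arrows, arity] using ih

/-- `w(σ₀, …, σᵣ₋₁ → nat) = max (r, w(σ₀), …, w(σᵣ₋₁))`. -/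
theorem width_arrows (σs : List Ty) :
    (arrows σs).width = max σs.length ((σs.map width).foldr max 0) := by
  induction σs with
  | nil => rfl
  | cons σ σs ih =>
    have h1 := arity_arrows σs
    simp only [arrows, List.foldr_cons, width, List.length_cons, List.map_cons] at *
    rw [h1, ih]
    omega

/-- The sublevel `(level, width)` of a type, ordered lexicographically with the level first.
The type `nat` gets the lowest pair `(0, 0)`. -/
def sublevel (σ : Ty) : ℕ ×ₗ ℕ := toLex (σ.level, σ.width)

/-- The homogeneous types: `ρ₀,ₗ = nat` and `ρₖ₊₁,ₗ = ρₖ,ₗ, …, ρₖ,ₗ → nat` with `l` arguments. -/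
def rho : ℕ → ℕ → Ty
  | 0, _ => nat
  | k + 1, l => arrows (List.replicate l (rho k l))

end Ty

/-- Typing environments. -/
abbrev Env : Type := List Ty

/-- Typed de Bruijn variables: positions of a type in an environment. -/
inductive Var : Env → Ty → Type
  | zero {Γ : Env} {σ : Ty} : Var (σ :: Γ) σ
  | succ {Γ : Env} {σ τ : Ty} : Var Γ σ → Var (τ :: Γ) σ

/-- Well-typed terms `Γ ⊢ M : σ` of PCF with an oracle constant for every partial function
from `ℕ` to `ℕ`. -/
inductive Tm : Env → Ty → Type
  | var {Γ : Env} {σ : Ty} : Var Γ σ → Tm Γ σ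
  | lam {Γ : Env} {σ τ : Ty} : Tm (σ :: Γ) τ → Tm Γ (.arr σ τ)
  | app {Γ : Env} {σ τ : Ty} : Tm Γ (.arr σ τ) → Tm Γ σ → Tm Γ τ
  | num {Γ : Env} : ℕ → Tm Γ .nat
  | suc {Γ : Env} : Tm Γ (.arr .nat .nat)
  | pre {Γ : Env} : Tm Γ (.arr .nat .nat)
  | ifzero {Γ : Env} : Tm Γ (.arr .nat (.arr .nat (.arr .nat .nat)))
  | fix {Γ : Env} (σ : Ty) : Tm Γ (.arr (.arr σ σ) σ)
  | oracle {Γ : Env} (f : ℕ →. ℕ) : Tm Γ (.arr .nat .nat)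

/-- Renamings of variables. -/
abbrev Ren (Γ Δ : Env) : Type := ∀ σ : Ty, Var Γ σ → Var Δ σ

/-- Simultaneous substitutions: a term in environment `Δ` for each variable of `Γ`. In other
words, if `Γ = [σ₀, …, σₘ₋₁]`, a tuple of terms `Δ ⊢ tᵢ : σᵢ`. -/
abbrev Subst (Γ Δ : Env) : Type := ∀ σ : Ty, Var Γ σ → Tm Δ σ

/-- A renaming under a binder. -/
def Ren.lift {Γ Δ : Env} (f : Ren Γ Δ) (τ : Ty) : Ren (τ :: Γ) (τ :: Δ)
  | _, .zero => .zero
  | _, .succ x => .succ (f _ x)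

/-- Renaming of the free variables of a term. -/
def Tm.rename : {Γ Δ : Env} → {σ : Ty} → Ren Γ Δ → Tm Γ σ → Tm Δ σ
  | _, _, _, f, .var x => .var (f _ x)
  | _, _, _, f, .lam M => .lam (M.rename (f.lift _))
  | _, _, _, f, .app M N => .app (M.rename f) (N.rename f)
  | _, _, _, _, .num n => .num n
  | _, _, _, _, .suc => .suc
  | _, _, _, _, .pre => .pre
  | _, _, _, _, .ifzero => .ifzero
  | _, _, _, _, .fix σ => .fix σ
  | _, _, _, _, .oracle f => .oracle f

/-- A substitution under a binder. -/
def Subst.lift {Γ Δ : Env} (s : Subst Γ Δ) (τ : Ty) : Subst (τ :: Γ) (τ :: Δ)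
  | _, .zero => .var .zero
  | _, .succ x => (s _ x).rename (fun _ => Var.succ)

/-- Simultaneous capture-avoiding substitution. -/
def Tm.subst : {Γ Δ : Env} → {σ : Ty} → Subst Γ Δ → Tm Γ σ → Tm Δ σ
  | _, _, _, s, .var x => s _ x
  | _, _, _, s, .lam M => .lam (M.subst (s.lift _))
  | _, _, _, s, .app M N => .app (M.subst s) (N.subst s)
  | _, _, _, _, .num n => .num n
  | _, _, _, _, .suc => .suc
  | _, _, _, _, .pre => .pre
  | _, _, _, _, .ifzero => .ifzero
  | _, _, _, _, .fix σ => .fix σ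
  | _, _, _, _, .oracle f => .oracle f

/-- The substitution of `N` for the most recent variable. -/
def Subst.single {Γ : Env} {τ : Ty} (N : Tm Γ τ) : Subst (τ :: Γ) Γ
  | _, .zero => N
  | _, .succ x => .var x

/-- Closed terms. -/
abbrev Closed (σ : Ty) : Type := Tm [] σ

/-- The unique renaming out of the empty environment. -/
def Ren.ofNil (Γ : Env) : Ren [] Γ := fun _ x => nomatch x

/-- A closed term regarded as a term in an arbitrary environment. -/
def Tm.weaken {σ : Ty} (M : Closed σ) (Γ : Env) : Tm Γ σ := M.rename (Ren.ofNil Γ)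

/-- One-step reduction of closed terms: the basic rules, closed under the evaluation contexts
`[-] N`, `suc [-]`, `pre [-]`, `ifzero [-]` and `C_f [-]`. -/
inductive Step : {σ : Ty} → Closed σ → Closed σ → Prop
  | beta {σ τ : Ty} (M : Tm [σ] τ) (N : Closed σ) :
      Step (.app (.lam M) N) (M.subst (Subst.single N))
  | suc_num (n : ℕ) : Step (.app .suc (.num n)) (.num (n + 1))
  | pre_succ (n : ℕ) : Step (.app .pre (.num (n + 1))) (.num n)
  | pre_zero : Step (.app .pre (.num 0)) (.num 0)
  | ifzero_zero : Step (.app .ifzero (.num 0)) (.lam (.lam (.var (.succ .zero))))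
  | ifzero_succ (n : ℕ) : Step (.app .ifzero (.num (n + 1))) (.lam (.lam (.var .zero)))
  | fix {σ : Ty} (M : Closed (.arr σ σ)) :
      Step (.app (.fix σ) M) (.app M (.app (.fix σ) M))
  | oracle (f : ℕ →. ℕ) (n m : ℕ) (h : m ∈ f n) : Step (.app (.oracle f) (.num n)) (.num m)
  | app_left {σ τ : Ty} {M M' : Closed (.arr σ τ)} (N : Closed σ) (h : Step M M') :
      Step (.app M N) (.app M' N)
  | suc_arg {M M' : Closed .nat} (h : Step M M') : Step (.app .suc M) (.app .suc M')
  | pre_arg {M M' : Closed .nat} (h : Step M M') : Step (.app .pre M) (.app .pre M')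
  | ifzero_arg {M M' : Closed .nat} (h : Step M M') : Step (.app .ifzero M) (.app .ifzero M')
  | oracle_arg (f : ℕ →. ℕ) {M M' : Closed .nat} (h : Step M M') :
      Step (.app (.oracle f) M) (.app (.oracle f) M')

/-- The closed program `M` evaluates to the numeral `n`. -/
def EvalsTo (M : Closed .nat) (n : ℕ) : Prop := Relation.ReflTransGen Step M (.num n)

/-- `Context σ Γ τ`: single-hole contexts `Γ ⊢ C[-] : τ` whose hole takes closed terms of
type `σ`. -/
inductive Context (σ : Ty) : Env → Ty → Type
  | hole {Γ : Env} : Context σ Γ σ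
  | lam {Γ : Env} {τ υ : Ty} : Context σ (τ :: Γ) υ → Context σ Γ (.arr τ υ)
  | appL {Γ : Env} {τ υ : Ty} : Context σ Γ (.arr τ υ) → Tm Γ τ → Context σ Γ υ
  | appR {Γ : Env} {τ υ : Ty} : Tm Γ (.arr τ υ) → Context σ Γ τ → Context σ Γ υ

/-- `C[M]`. -/
def Context.plug {σ : Ty} : {Γ : Env} → {τ : Ty} → Context σ Γ τ → Closed σ → Tm Γ τ
  | Γ, _, .hole, M => M.weaken Γ
  | _, _, .lam C, M => .lam (C.plug M)
  | _, _, .appL C N, M => .app (C.plug M) N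
  | _, _, .appR N C, M => .app N (C.plug M)

/-- Observational equivalence of closed terms. -/
def ObsEq {σ : Ty} (M M' : Closed σ) : Prop :=
  ∀ (C : Context σ [] .nat) (n : ℕ), EvalsTo (C.plug M) n ↔ EvalsTo (C.plug M') n

/-- Observational equivalence as a setoid on the closed terms of a type. -/
instance obsSetoid (σ : Ty) : Setoid (Closed σ) where
  r := ObsEq
  iseqv := ⟨fun _ _ _ => Iff.rfl, fun h C n => (h C n).symm,
    fun h h' C n => (h C n).trans (h' C n)⟩

/-- The context `C[[-] N]`. -/
def Context.holeAppArg {σ τ : Ty} (N : Closed σ) :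
    {Γ : Env} → {υ : Ty} → Context τ Γ υ → Context (.arr σ τ) Γ υ
  | Γ, _, .hole => .appL .hole (N.weaken Γ)
  | _, _, .lam C => .lam (C.holeAppArg N)
  | _, _, .appL C M => .appL (C.holeAppArg N) M
  | _, _, .appR M C => .appR M (C.holeAppArg N)

/-- The context `C[M [-]]`. -/
def Context.funAppHole {σ τ : Ty} (M : Closed (.arr σ τ)) :
    {Γ : Env} → {υ : Ty} → Context τ Γ υ → Context σ Γ υ
  | Γ, _, .hole => .appR (M.weaken Γ) .hole
  | _, _, .lam C => .lam (C.funAppHole M)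
  | _, _, .appL C N => .appL (C.funAppHole M) N
  | _, _, .appR N C => .appR N (C.funAppHole M)

theorem Context.plug_holeAppArg {σ τ : Ty} (M : Closed (.arr σ τ)) (N : Closed σ)
    {Γ : Env} {υ : Ty} (C : Context τ Γ υ) :
    (C.holeAppArg N).plug M = C.plug (.app M N) := by
  induction C with
  | hole => rfl
  | lam C ih => simp [Context.holeAppArg, Context.plug, ih]
  | appL C L ih => simp [Context.holeAppArg, Context.plug, ih]
  | appR L C ih => simp [Context.holeAppArg, Context.plug, ih]

theorem Context.plug_funAppHole {σ τ : Ty} (M : Closed (.arr σ τ)) (N : Closed σ)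
    {Γ : Env} {υ : Ty} (C : Context τ Γ υ) :
    (C.funAppHole M).plug N = C.plug (.app M N) := by
  induction C with
  | hole => rfl
  | lam C ih => simp [Context.funAppHole, Context.plug, ih]
  | appL C L ih => simp [Context.funAppHole, Context.plug, ih]
  | appR L C ih => simp [Context.funAppHole, Context.plug, ih]

theorem ObsEq.app {σ τ : Ty} {M M' : Closed (.arr σ τ)} {N N' : Closed σ}
    (hM : ObsEq M M') (hN : ObsEq N N') : ObsEq (Tm.app M N) (Tm.app M' N') := by
  intro C n
  rw [← Context.plug_holeAppArg M N C, hM (C.holeAppArg N) n, Context.plug_holeAppArg,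
    ← Context.plug_funAppHole M' N C, hN (C.funAppHole M') n, Context.plug_funAppHole]

theorem Tm.rename_id {Γ : Env} {σ : Ty} (M : Tm Γ σ) (f : Ren Γ Γ)
    (hf : ∀ τ x, f τ x = x) : M.rename f = M := by
  have key : ∀ {Γ : Env} {σ : Ty} (M : Tm Γ σ), M.rename (fun _ x => x) = M := by
    intro Γ σ M
    induction M with
    | @lam Γ σ τ M ih =>
      have : Ren.lift (fun _ x => x : Ren Γ Γ) σ = fun _ x => x := by
        funext υ x
        cases x <;> rfl
      simp [Tm.rename, this, ih]
    | _ => simp_all [Tm.rename]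
  have : f = fun _ x => x := by
    funext τ x
    exact hf τ x
  rw [this, key]

theorem Tm.weaken_nil {σ : Ty} (M : Closed σ) : M.weaken [] = M :=
  M.rename_id _ (fun _ x => nomatch x)

/-- The model of sequential functionals at type `σ`: closed terms modulo observational
equivalence. -/
def SF (σ : Ty) : Type := Quotient (obsSetoid σ)

namespace SF

/-- The denotation of a closed term: its equivalence class. -/
def mk {σ : Ty} (M : Closed σ) : SF σ := Quotient.mk (obsSetoid σ) M

/-- Application in the model. -/
def app {σ τ : Ty} : SF (.arr σ τ) → SF σ → SF τ :=
  Quotient.map₂ (fun M N => Tm.app M N) (fun _ _ hM _ _ hN => ObsEq.app hM hN)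

/-- `x` is the element `n` of `SF(nat) ≅ ℕ ⊔ {⊥}`; `x` is `⊥` if this holds for no `n`. -/
def IsNum (x : SF .nat) (n : ℕ) : Prop :=
  Quotient.lift (fun M => EvalsTo M n)
    (fun M M' h => propext (by
      have := h Context.hole n
      simpa only [Context.plug, Tm.weaken_nil] using this)) x

/-- The information ordering on `SF(nat) ≅ ℕ ⊔ {⊥}`. -/
def InfoLe (x y : SF .nat) : Prop := ∀ n : ℕ, IsNum x n → IsNum y n

/-- The observational ordering: `x ≼ x'` iff `h · x ⊑ h · x'` for all `h` in `SF(σ → nat)`. -/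
def ObsLe {σ : Ty} (x x' : SF σ) : Prop :=
  ∀ h : SF (.arr σ .nat), InfoLe (app h x) (app h x')

end SF

/-- `Dominates M M'`, for terms `z : ρ ⊢ M, M' : τ`, is `z ⊢ M ≽ M'`: the elements denoted by
`λz. M` and `λz. M'` satisfy `λz. M ≽ λz. M'`. -/
def Dominates {ρ τ : Ty} (M M' : Tm [ρ] τ) : Prop :=
  SF.ObsLe (SF.mk (.lam M')) (SF.mk (.lam M))

/-- Within `SF`, the type `ρ` is a pseudo-retract of the product of the list of types
`σs = [σ₀, …, σₘ₋₁]`: there are `z : ρ ⊢ tᵢ : σᵢ` and `x₀ : σ₀, …, xₘ₋₁ : σₘ₋₁ ⊢ r : ρ` with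
`z ⊢ r[x₀ ↦ t₀, …, xₘ₋₁ ↦ tₘ₋₁] ≽ z`. -/
def PseudoRetract (ρ : Ty) (σs : List Ty) : Prop :=
  ∃ (t : Subst σs [ρ]) (r : Tm σs ρ), Dominates (r.subst t) (.var .zero)

end PCF

namespace PCF

/-! ### Syntactic substitution lemmas -/

-- Write `k = j + 1`, so that the type in question is `Ty.arrows Ξ`, where `Ξ` consists of `l + 1`
-- copies of `Ty.rho j (l + 1)`. Suppose that `r[t(z)]` dominates `z`, and consider the program
-- `r[t(z)] x` in a functional variable `z` and arguments `x : Ξ`. It must return `c` whenever `z x`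
-- returns `c`. The contradiction is that such a program either ignores its input, which the
-- constant functions 0 and 1 exclude, or diverges at some point where `z x` converges.
--
-- The reason for this dichotomy is that `t` sees `x` only through the arguments that `r` passes to
-- it, and these have sublevel at most `(j, l)`. Hence every call `z a` made inside `t` has
-- arguments `a` computed from `z` and from an environment `Γ` of such types. By induction on `j`,
-- the tuple `x` cannot be recovered from `Γ` (`Separated`): some test is passed by a component of
-- `x` and failed by that of `a`. Taking for `z` the function that performs this test makes `z x`
-- converge and `z a` diverge (`Separated.diverges`). Logical relations carry the dichotomy from the
-- calls of `z` to the whole program: one relation for `t`, whose worlds are the environments `Γ`,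
-- and one for `r`, compared in `outer_inner`. This gives the inductive step
-- `Separated.exists_fail`. At the bottom, `separated_nat` shows by counting defined components that
-- `l + 1` numbers cannot be recovered from `l`.
--
-- Recursion is interpreted in the full type hierarchy by `K` unfoldings, so no limits occur in the
-- logical relations. A computation is reflected only for large `K`, whereas the separating points
-- and tests depend on `K`. They are therefore drawn from finite sets `pts` and `tests` independent
-- of `K`, and one `K` serves for all of them.

theorem Tm.rename_subst {Γ Δ Θ : Env} {σ : Ty} (M : Tm Γ σ) (f : Ren Γ Δ) (s : Subst Δ Θ) :
    (M.rename f).subst s = M.subst (fun τ x => s τ (f τ x)) := by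
  induction M generalizing Δ Θ with
  | @lam Γ σ τ M ih =>
    have : (fun υ x => s.lift σ υ (f.lift σ υ x)) =
        Subst.lift (fun τ x => s τ (f τ x)) σ := by
      funext υ x
      cases x <;> rfl
    simp only [Tm.rename, Tm.subst, ih, this]
  | app M N ihM ihN => simp only [Tm.rename, Tm.subst, ihM, ihN]
  | _ => rfl

theorem Tm.subst_var {Γ Δ : Env} {σ : Ty} (M : Tm Γ σ) (f : Ren Γ Δ) :
    M.subst (fun τ x => .var (f τ x)) = M.rename f := by
  induction M generalizing Δ with
  | @lam Γ σ τ M ih =>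
    have : Subst.lift (fun τ x => .var (f τ x)) σ =
        fun υ x => Tm.var (f.lift σ υ x) := by
      funext υ x
      cases x <;> rfl
    simp only [Tm.rename, Tm.subst, ← ih, this]
  | app M N ihM ihN => simp only [Tm.rename, Tm.subst, ihM, ihN]
  | _ => rfl

theorem Tm.weaken_subst {Γ Δ : Env} {σ : Ty} (M : Closed σ) (s : Subst Γ Δ) :
    (M.weaken Γ).subst s = M.weaken Δ := by
  rw [Tm.weaken, Tm.weaken, Tm.rename_subst, ← Tm.subst_var]
  congr 1
  funext τ x
  cases x

theorem Tm.weaken_subst_nil {Γ : Env} {σ : Ty} (M : Closed σ) (s : Subst Γ []) :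
    (M.weaken Γ).subst s = M := by
  rw [Tm.weaken_subst, Tm.weaken_nil]

theorem Tm.rename_succ_subst_single {Γ : Env} {σ τ : Ty} (M : Tm Γ σ) (N : Tm Γ τ) :
    (M.rename (fun _ => Var.succ)).subst (Subst.single N) = M := by
  rw [Tm.rename_subst]
  exact (Tm.subst_var M (fun _ x => x)).trans (M.rename_id _ fun _ _ => rfl)

/-! ### A model with bounded recursion -/

/-- The full type hierarchy over the partial natural numbers. -/
def D : Ty → Type
  | .nat => Part ℕ
  | .arr σ τ => D σ → D τ

/-- Environments of elements of the model. -/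
abbrev Den (Γ : Env) : Type := ∀ σ : Ty, Var Γ σ → D σ

/-- The extension of an environment by a value for a new variable. -/
def Den.cons {Γ : Env} {σ : Ty} (a : D σ) (γ : Den Γ) : Den (σ :: Γ)
  | _, .zero => a
  | _, .succ x => γ _ x

/-- The empty environment. -/
def Den.nil : Den [] := fun _ x => nomatch x

theorem Den.eq_nil (γ : Den []) : γ = Den.nil := by
  funext σ x
  cases x

theorem Den.eta {Γ : Env} {σ : Ty} (γ : Den (σ :: Γ)) :
    Den.cons (γ _ .zero) (fun τ x => γ τ x.succ) = γ := by
  funext τ x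
  cases x <;> rfl

/-- The undefined element. -/
def bot : (σ : Ty) → D σ
  | .nat => (Part.none : Part ℕ)
  | .arr _ τ => fun _ => bot τ

/-- The denotation of terms in which recursion is unfolded `K` times. -/
def Tm.den (K : ℕ) : {Γ : Env} → {σ : Ty} → Tm Γ σ → Den Γ → D σ
  | _, _, .var x, γ => γ _ x
  | _, _, .lam M, γ => fun a => M.den K (γ.cons a)
  | _, _, .app M N, γ => M.den K γ (N.den K γ)
  | _, _, .num n, _ => Part.some n
  | _, _, .suc, _ => fun a : Part ℕ => a.bind fun n => Part.some (n + 1)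
  | _, _, .pre, _ => fun a : Part ℕ => a.bind fun n => Part.some (n - 1)
  | _, _, .ifzero, _ => fun a b c : Part ℕ => a.bind fun n => if n = 0 then b else c
  | _, _, .fix σ, _ => fun f : D σ → D σ => f^[K] (bot σ)
  | _, _, .oracle f, _ => fun a : Part ℕ => a.bind f

theorem Den.cons_lift {Γ Δ : Env} {σ : Ty} (f : Ren Γ Δ) (γ : Den Δ) (a : D σ) :
    (fun τ x => γ.cons a τ (f.lift σ τ x)) = Den.cons a (fun τ x => γ τ (f τ x)) := by
  funext τ x
  cases x <;> rfl

theorem Tm.den_rename (K : ℕ) {Γ Δ : Env} {σ : Ty} (M : Tm Γ σ) (f : Ren Γ Δ) (γ : Den Δ) :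
    (M.rename f).den K γ = M.den K (fun τ x => γ τ (f τ x)) := by
  induction M generalizing Δ with
  | lam M ih =>
    funext a
    simp only [Tm.rename, Tm.den, ih, Den.cons_lift]
  | app M N ihM ihN => simp only [Tm.rename, Tm.den, ihM, ihN]
  | _ => rfl

theorem Tm.den_subst (K : ℕ) {Γ Δ : Env} {σ : Ty} (M : Tm Γ σ) (s : Subst Γ Δ) (γ : Den Δ) :
    (M.subst s).den K γ = M.den K (fun τ x => (s τ x).den K γ) := by
  induction M generalizing Δ with
  | @lam Γ σ τ M ih =>
    funext a
    have : (fun υ x => (s.lift σ υ x).den K (γ.cons a)) =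
        Den.cons a (fun υ x => (s υ x).den K γ) := by
      funext υ x
      cases x with
      | zero => rfl
      | succ x => exact Tm.den_rename K _ _ _
    simp only [Tm.subst, Tm.den, ih, this]
  | app M N ihM ihN => simp only [Tm.subst, Tm.den, ihM, ihN]
  | _ => rfl

theorem Tm.den_weaken (K : ℕ) {Γ : Env} {σ : Ty} (M : Closed σ) (γ : Den Γ) :
    (M.weaken Γ).den K γ = M.den K Den.nil := by
  rw [Tm.weaken, Tm.den_rename]
  congr 1
  exact Den.eq_nil _

theorem Tm.den_single (K : ℕ) {Γ : Env} {σ τ : Ty} (M : Tm (σ :: Γ) τ) (N : Tm Γ σ) (γ : Den Γ) :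
    (M.subst (Subst.single N)).den K γ = M.den K (γ.cons (N.den K γ)) := by
  rw [Tm.den_subst]
  congr 1
  funext υ x
  cases x <;> rfl

/-- The hereditary information ordering. -/
def Le : (σ : Ty) → D σ → D σ → Prop
  | .nat => fun a b : Part ℕ => a ≤ b
  | .arr σ τ => fun F F' => ∀ a a' : D σ, Le σ a a' → Le τ (F a) (F' a')

theorem bot_le : ∀ (σ : Ty) (a : D σ), Le σ (bot σ) a
  | .nat, _ => OrderBot.bot_le (α := Part ℕ) _
  | .arr _ τ, _ => fun _ _ _ => bot_le τ _

/-- The hereditary information ordering on environments. -/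
abbrev Den.Le {Γ : Env} (γ γ' : Den Γ) : Prop := ∀ (σ : Ty) (x : Var Γ σ), PCF.Le σ (γ σ x) (γ' σ x)

theorem Den.Le.cons {Γ : Env} {σ : Ty} {a a' : D σ} {γ γ' : Den Γ} (ha : PCF.Le σ a a')
    (h : γ.Le γ') : (γ.cons a).Le (γ'.cons a')
  | _, .zero => ha
  | _, .succ x => h _ x

theorem part_bind_mono {a a' : Part ℕ} {f f' : ℕ → Part ℕ} (h : a ≤ a') (hf : ∀ n, f n ≤ f' n) :
    a.bind f ≤ a'.bind f' := by
  intro m hm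
  obtain ⟨n, hn, hm⟩ := Part.mem_bind_iff.1 hm
  exact Part.mem_bind_iff.2 ⟨n, h n hn, hf n m hm⟩

theorem iterate_bot_le {σ : Ty} {f f' : D σ → D σ} (h : Le (.arr σ σ) f f') (K n : ℕ) :
    Le σ (f^[K] (bot σ)) (f'^[K + n] (bot σ)) := by
  induction K with
  | zero => exact bot_le σ _
  | succ K ih =>
    rw [show K + 1 + n = (K + n) + 1 by omega, Function.iterate_succ_apply',
      Function.iterate_succ_apply']
    exact h _ _ ih

theorem apply_iterate_bot_le {σ : Ty} {f f' : D σ → D σ} (h : Le (.arr σ σ) f f') (K : ℕ) :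
    Le σ (f (f^[K] (bot σ))) (f'^[K + 1] (bot σ)) := by
  rw [← Function.iterate_succ_apply' f]
  exact iterate_bot_le h (K + 1) 0

theorem Tm.den_mono {K K' : ℕ} (hK : K ≤ K') {Γ : Env} {σ : Ty} (M : Tm Γ σ) {γ γ' : Den Γ}
    (h : γ.Le γ') : Le σ (M.den K γ) (M.den K' γ') := by
  induction M with
  | var x => exact h _ x
  | lam M ih => exact fun a a' ha => ih (Den.Le.cons ha h)
  | app M N ihM ihN => exact ihM h _ _ (ihN h)
  | num n => exact le_refl (α := Part ℕ) _
  | suc => exact fun a a' ha => part_bind_mono ha fun _ => le_rfl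
  | pre => exact fun a a' ha => part_bind_mono ha fun _ => le_rfl
  | ifzero =>
    refine fun a a' ha b b' hb c c' hc => part_bind_mono ha fun n => ?_
    cases n with
    | zero => exact hb
    | succ n => exact hc
  | fix σ =>
    obtain ⟨n, rfl⟩ := Nat.exists_eq_add_of_le hK
    exact fun f f' hf => iterate_bot_le hf K n
  | oracle f => exact fun a a' ha => part_bind_mono ha fun _ => le_rfl

theorem Den.nil_le : Den.nil.Le Den.nil := fun _ x => nomatch x

theorem Tm.den_self {K : ℕ} {σ : Ty} (M : Closed σ) :
    Le σ (M.den K Den.nil) (M.den K Den.nil) :=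
  M.den_mono le_rfl Den.nil_le

/-- The extra unfolding pays for the rule of `fix`: a function applied to its `K`-th iterate on
bottom is the next iterate. For the other rules monotonicity in `K` suffices. -/
theorem Step.den_le {σ : Ty} {M M' : Closed σ} (h : Step M M') (K : ℕ) :
    Le σ (M'.den K Den.nil) (M.den (K + 1) Den.nil) := by
  have hK : K ≤ K + 1 := Nat.le_succ K
  induction h with
  | beta M N =>
    rw [Tm.den_single]
    exact M.den_mono hK (Den.Le.cons (N.den_mono hK Den.nil_le) Den.nil_le)
  | suc_num n => simp [Tm.den, Le]
  | pre_succ n => simp [Tm.den, Le]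
  | pre_zero => simp [Tm.den, Le]
  | ifzero_zero =>
    intro a a' ha b b' _
    simpa [Tm.den, Den.cons] using ha
  | ifzero_succ n =>
    intro a a' _ b b' hb
    simpa [Tm.den, Den.cons] using hb
  | @fix σ M =>
    exact apply_iterate_bot_le (M.den_mono hK Den.nil_le) K
  | oracle f n m h =>
    exact fun i hi => Part.mem_bind_iff.2 ⟨n, Part.mem_some n, Part.mem_some_iff.1 hi ▸ h⟩
  | app_left N _ ih => exact ih _ _ (N.den_mono hK Den.nil_le)
  | suc_arg _ ih => exact part_bind_mono ih fun _ => le_rfl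
  | pre_arg _ ih => exact part_bind_mono ih fun _ => le_rfl
  | ifzero_arg _ ih =>
    exact fun b b' hb c c' hc => Tm.den_mono (Γ := []) hK .ifzero Den.nil_le _ _ ih b b' hb c c' hc
  | oracle_arg f _ ih => exact part_bind_mono ih fun _ => le_rfl

/-- A computation is reflected by the model once recursion is unfolded far enough. -/
theorem EvalsTo.exists_den {M : Closed .nat} {n : ℕ} (h : EvalsTo M n) :
    ∃ K₀, ∀ K, K₀ ≤ K → M.den K Den.nil = Part.some n := by
  suffices ∃ K, n ∈ (show Part ℕ from M.den K Den.nil) by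
    obtain ⟨K₀, hK₀⟩ := this
    exact ⟨K₀, fun K hK => Part.eq_some_iff.2 (M.den_mono hK Den.nil_le n hK₀)⟩
  induction h using Relation.ReflTransGen.head_induction_on with
  | refl => exact ⟨0, Part.mem_some n⟩
  | head h _ ih =>
    obtain ⟨K, hK⟩ := ih
    exact ⟨K + 1, h.den_le K n hK⟩

/-! ### Application to several arguments -/

/-- The application of a term to arguments for all the variables of an environment. -/
def Tm.apps {Δ : Env} : (Γ : Env) → Tm Δ (Ty.arrows Γ) → Subst Γ Δ → Tm Δ .nat
  | [], M, _ => M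
  | _ :: Γ, M, θ => Tm.apps Γ (.app M (θ _ .zero)) (fun τ x => θ τ x.succ)

/-- The application of an element of the model to a whole environment. -/
def sapps : (Γ : Env) → D (Ty.arrows Γ) → Den Γ → Part ℕ
  | [], a, _ => a
  | _ :: Γ, F, γ => sapps Γ (F (γ _ .zero)) (fun τ x => γ τ x.succ)

theorem Tm.den_apps (K : ℕ) {Δ : Env} : (Γ : Env) → (M : Tm Δ (Ty.arrows Γ)) → (θ : Subst Γ Δ) →
    (γ : Den Δ) →
    (Tm.apps Γ M θ).den K γ = sapps Γ (M.den K γ) (fun τ x => (θ τ x).den K γ)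
  | [], _, _, _ => rfl
  | _ :: Γ, M, θ, γ => Tm.den_apps K Γ (.app M (θ _ .zero)) (fun τ x => θ τ x.succ) γ

theorem Step.apps : (Γ : Env) → {M M' : Closed (Ty.arrows Γ)} → (θ : Subst Γ []) → Step M M' →
    Step (Tm.apps Γ M θ) (Tm.apps Γ M' θ)
  | [], _, _, _, h => h
  | _ :: Γ, _, _, θ, h => Step.apps Γ (fun τ x => θ τ x.succ) (h.app_left _)

theorem le_of_sapps : (Γ : Env) → (F F' : D (Ty.arrows Γ)) →
    (∀ γ γ' : Den Γ, γ.Le γ' → sapps Γ F γ ≤ sapps Γ F' γ') → Le (Ty.arrows Γ) F F'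
  | [], _, _, h => h Den.nil Den.nil Den.nil_le
  | _ :: Γ, F, F', h => fun a a' ha => le_of_sapps Γ (F a) (F' a') fun _ _ hγ =>
      h _ _ (Den.Le.cons ha hγ)

theorem EvalsTo.of_step {M M' : Closed .nat} {n : ℕ} (h : Step M M') (h' : EvalsTo M' n) :
    EvalsTo M n :=
  Relation.ReflTransGen.head h h'

/-! ### Tests -/

/-- A test for closed terms of type `σ`: a list of arguments and an expected result. -/
def Test : Ty → Type
  | .nat => ℕ
  | .arr σ τ => Closed σ × Test τ

/-- The partial function that is defined at `c` only, with value `0`. -/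
def accept (c : ℕ) : ℕ →. ℕ := fun n => if n = c then Part.some 0 else Part.none

/-- The closed term performing a test. -/
def Test.term : {σ : Ty} → Test σ → Closed (.arr σ .nat)
  | .nat, c => .oracle (accept c)
  | .arr _ _, (f, h) =>
      .lam (.app ((Test.term h).weaken _) (.app (.var .zero) (f.weaken _)))

/-- Passing a test, operationally. -/
def Test.Pass : {σ : Ty} → Test σ → Closed σ → Prop
  | .nat, c, M => EvalsTo M c
  | .arr _ _, (f, h), M => Test.Pass h (.app M f)

/-- The test with given arguments and a given expected result. -/
def Test.ofArgs : (Γ : Env) → Subst Γ [] → ℕ → Test (Ty.arrows Γ)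
  | [], _, c => c
  | _ :: Γ, f, c => (f _ .zero, Test.ofArgs Γ (fun τ x => f τ x.succ) c)

theorem Test.pass_ofArgs : (Γ : Env) → (f : Subst Γ []) → (c : ℕ) → (M : Closed (Ty.arrows Γ)) →
    ((Test.ofArgs Γ f c).Pass M ↔ EvalsTo (Tm.apps Γ M f) c)
  | [], _, _, _ => Iff.rfl
  | _ :: Γ, f, c, M => Test.pass_ofArgs Γ (fun τ x => f τ x.succ) c (.app M (f _ .zero))

theorem Test.pass_of_step : {σ : Ty} → (h : Test σ) → {M M' : Closed σ} → Step M M' → h.Pass M' →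
    h.Pass M
  | .nat, _, _, _, s, p => EvalsTo.of_step s p
  | .arr _ _, (_, h), _, _, s, p => Test.pass_of_step h (s.app_left _) p

theorem EvalsTo.oracle_arg {M : Closed .nat} {n m : ℕ} {f : ℕ →. ℕ} (h : EvalsTo M n)
    (hm : m ∈ f n) : EvalsTo (.app (.oracle f) M) m := by
  have key : ∀ M', Relation.ReflTransGen Step M M' →
      Relation.ReflTransGen Step (Tm.app (.oracle f) M) (.app (.oracle f) M') := by
    intro M' h
    induction h with
    | refl => exact .refl
    | tail _ s ih => exact ih.tail (Step.oracle_arg f s)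
  exact (key _ h).tail (Step.oracle f n m hm)

theorem zero_mem_accept (c : ℕ) : 0 ∈ accept c c := by simp [accept]

theorem eq_zero_of_mem_accept {c n m : ℕ} (h : m ∈ accept c n) : m = 0 := by
  unfold accept at h
  split_ifs at h
  · exact Part.mem_some_iff.1 h
  · exact absurd h (Part.notMem_none m)

theorem Test.beta {σ τ : Ty} (f : Closed σ) (h : Test τ) (M : Closed (.arr σ τ)) :
    Step (.app (Test.term (σ := .arr σ τ) (f, h)) M) (.app h.term (.app M f)) := by
  have := Step.beta (.app (h.term.weaken _) (.app (.var .zero) (f.weaken _))) M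
  simp only [Tm.subst, Tm.weaken_subst_nil] at this
  exact this

theorem Test.Pass.evalsTo : {σ : Ty} → {h : Test σ} → {M : Closed σ} → h.Pass M →
    EvalsTo (.app h.term M) 0
  | .nat, c, _, p => EvalsTo.oracle_arg (n := c) p (zero_mem_accept c)
  | .arr _ _, (_, h), _, p => .of_step (Test.beta _ _ _) (Test.Pass.evalsTo (h := h) p)

/-- The semantics of a test. -/
def Test.den (K : ℕ) {σ : Ty} (h : Test σ) (a : D σ) : Part ℕ := h.term.den K Den.nil a

theorem Test.den_arr (K : ℕ) {σ τ : Ty} (f : Closed σ) (h : Test τ) (F : D (.arr σ τ)) :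
    Test.den K (σ := .arr σ τ) (f, h) F = h.den K (F (f.den K Den.nil)) := by
  simp only [Test.den, Test.term, Tm.den, Tm.den_weaken]
  rfl

theorem Test.den_ofArgs (K : ℕ) : (Γ : Env) → (f : Subst Γ []) → (c : ℕ) →
    (F : D (Ty.arrows Γ)) →
    (Test.ofArgs Γ f c).den K F =
      (sapps Γ F fun τ x => (f τ x).den K Den.nil).bind (accept c)
  | [], _, _, _ => rfl
  | _ :: Γ, _, c, F => (Test.den_arr K _ _ F).trans (Test.den_ofArgs K Γ _ c _)

/-- This makes the constant function 0 an upper bound of all functions that test an argument. -/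
theorem Test.den_le (K : ℕ) : {σ : Ty} → (h : Test σ) → (a : D σ) → h.den K a ≤ Part.some 0
  | .nat, c, a => by
    intro m hm
    obtain ⟨n, _, hm⟩ := Part.mem_bind_iff.1 (show m ∈ Part.bind a (accept c) from hm)
    exact Part.mem_some_iff.2 (eq_zero_of_mem_accept hm)
  | .arr _ _, (_, h), F => by
    rw [Test.den_arr]
    exact Test.den_le K h _

theorem Test.den_mono (K : ℕ) {σ : Ty} (h : Test σ) {a a' : D σ} (ha : Le σ a a') :
    h.den K a ≤ h.den K a' :=
  h.term.den_self _ _ ha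

theorem Test.den_eq_none {K : ℕ} {σ : Ty} (h : Test σ) {a : D σ} (ha : h.den K a ≠ Part.some 0) :
    h.den K a = Part.none := by
  rw [Part.eq_none_iff]
  intro m hm
  have := h.den_le K a m hm
  rw [Part.mem_some_iff] at this
  exact ha (Part.eq_some_iff.2 (this ▸ hm))

/-! ### Constant functions and projections -/

/-- The function with the given natural number as its constant value. -/
def constFun : (τ : Ty) → Closed (.arr .nat τ)
  | .nat => .lam (.var .zero)
  | .arr _ τ => .lam (.lam (.app ((constFun τ).weaken _) (.var (.succ .zero))))

theorem constFun_evalsTo : (Γ : Env) → (N : Closed .nat) → (θ : Subst Γ []) → (n : ℕ) →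
    EvalsTo N n → EvalsTo (Tm.apps Γ (.app (constFun (Ty.arrows Γ)) N) θ) n
  | [], N, _, _, h => .of_step (Step.beta (.var .zero) N) h
  | σ :: Γ, N, θ, n, h => by
    have h1 := Step.beta (.lam (.app ((constFun (Ty.arrows Γ)).weaken [σ, .nat])
      (.var (.succ .zero)))) N
    have h2 := Step.beta (.app ((constFun (Ty.arrows Γ)).weaken [σ])
      (N.rename (fun _ => Var.succ))) (θ _ .zero)
    simp only [Tm.subst, Subst.lift, Subst.single, Tm.weaken_subst_nil, Tm.weaken_subst,
      Tm.rename_succ_subst_single] at h1 h2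
    exact .of_step (Step.apps Γ _ (h1.app_left _)) <| .of_step (Step.apps Γ _ h2)
      (constFun_evalsTo Γ N _ n h)

theorem sapps_constFun (K : ℕ) : (Γ : Env) → (a : Part ℕ) → (γ : Den Γ) →
    sapps Γ ((constFun (Ty.arrows Γ)).den K Den.nil a) γ = a
  | [], _, _ => rfl
  | σ :: Γ, a, γ => by
    refine Eq.trans ?_ (sapps_constFun K Γ a (fun τ x => γ τ x.succ))
    refine congrArg (fun F => sapps Γ F (fun τ x => γ τ x.succ)) ?_
    exact congrFun (Tm.den_weaken K (constFun (Ty.arrows Γ)) _) a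

/-- A closed function ignoring its argument. -/
def constTm {τ : Ty} (σ : Ty) (z : Closed τ) : Closed (.arr σ τ) := .lam (z.weaken _)

/-- The function that tests its first argument. -/
def firstTm {σ : Ty} (τ : Ty) (h : Test σ) : Closed (.arr σ τ) :=
  .lam (.app ((constFun τ).weaken _) (.app (h.term.weaken _) (.var .zero)))

theorem constTm_step {σ τ : Ty} (z : Closed τ) (N : Closed σ) :
    Step (.app (constTm σ z) N) z := by
  have := Step.beta (z.weaken [σ]) N
  rwa [Tm.weaken_subst_nil] at this

theorem firstTm_step {σ τ : Ty} (h : Test σ) (N : Closed σ) :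
    Step (.app (firstTm τ h) N) (.app (constFun τ) (.app h.term N)) := by
  have := Step.beta (.app ((constFun τ).weaken _) (.app (h.term.weaken _) (.var .zero))) N
  simp only [Tm.subst, Tm.weaken_subst_nil] at this
  exact this

theorem constTm_den {σ τ : Ty} (K : ℕ) (z : Closed τ) (a : D σ) :
    (constTm σ z).den K Den.nil a = z.den K Den.nil :=
  Tm.den_weaken K z _

theorem firstTm_den {σ τ : Ty} (K : ℕ) (h : Test σ) (a : D σ) :
    (firstTm τ h).den K Den.nil a = (constFun τ).den K Den.nil (h.den K a) := by
  simp only [firstTm, Tm.den, Tm.den_weaken]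
  rfl

mutual

/-- A finite set of closed terms of each type. -/
def pts : (σ : Ty) → Set (Closed σ)
  | .nat => {.app (.oracle fun _ => Part.none) (.num 0), .num 0, .num 1}
  | .arr σ τ => constTm σ '' pts τ ∪ firstTm τ '' tests σ

/-- A finite set of tests of each type. -/
def tests : (σ : Ty) → Set (Test σ)
  | .nat => ({0, 1} : Set ℕ)
  | .arr σ τ => {p : Closed σ × Test τ | p.1 ∈ pts σ ∧ p.2 ∈ tests τ}

end

/-- Finiteness permits a common number of unfoldings for all pairs of a point and a test. -/
theorem finite_pts_tests (σ : Ty) : (pts σ).Finite ∧ (tests σ).Finite := by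
  induction σ with
  | nat =>
    refine ⟨?_, ?_⟩
    · rw [pts]
      exact Set.toFinite _
    · rw [tests]
      exact Set.toFinite ({0, 1} : Set ℕ)
  | arr σ τ ihσ ihτ =>
    refine ⟨?_, ?_⟩
    · rw [pts]
      exact (ihτ.1.image _).union (ihσ.2.image _)
    · rw [tests]
      exact ihσ.1.prod ihτ.2

theorem ofArgs_mem_tests : (Γ : Env) → (f : Subst Γ []) → (∀ τ x, f τ x ∈ pts τ) → (c : ℕ) →
    c ≤ 1 → Test.ofArgs Γ f c ∈ tests (Ty.arrows Γ)
  | [], f, _, c, hc => by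
    have : c ∈ ({0, 1} : Set ℕ) := by
      simp only [Set.mem_insert_iff, Set.mem_singleton_iff]
      omega
    have h : Test.ofArgs [] f c ∈ tests .nat := by
      rw [tests]
      exact this
    exact h
  | σ :: Γ, f, hf, c, hc => by
    have : Test.ofArgs (σ :: Γ) f c ∈ tests (.arr σ (Ty.arrows Γ)) := by
      rw [tests]
      exact ⟨hf _ _, ofArgs_mem_tests Γ _ (fun τ x => hf τ x.succ) c hc⟩
    exact this

theorem constTm_mem_pts {σ τ : Ty} {z : Closed τ} (hz : z ∈ pts τ) :
    constTm σ z ∈ pts (.arr σ τ) := by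
  rw [pts]
  exact .inl ⟨z, hz, rfl⟩

theorem firstTm_mem_pts {σ τ : Ty} {h : Test σ} (hh : h ∈ tests σ) :
    firstTm τ h ∈ pts (.arr σ τ) := by
  rw [pts]
  exact .inr ⟨h, hh, rfl⟩

theorem exists_bot_mem_pts (K : ℕ) : (σ : Ty) → ∃ z ∈ pts σ, z.den K Den.nil = bot σ
  | .nat => ⟨.app (.oracle fun _ => Part.none) (.num 0), by simp [pts],
      by simp only [Tm.den]; exact Part.bind_some _ _⟩
  | .arr σ τ => by
    obtain ⟨z, hz, h⟩ := exists_bot_mem_pts K τ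
    exact ⟨constTm σ z, constTm_mem_pts hz, funext fun a => (constTm_den K z a).trans h⟩

theorem exists_const_mem_pts (K : ℕ) (c : ℕ) (hc : c ≤ 1) : (Γ : Env) →
    ∃ z ∈ pts (Ty.arrows Γ), (∀ γ, sapps Γ (z.den K Den.nil) γ = Part.some c) ∧
      ∀ f : Subst Γ [], EvalsTo (Tm.apps Γ z f) c
  | [] => by
    refine ⟨.num c, ?_, fun _ => rfl, fun _ => .refl⟩
    have : (Tm.num c : Closed .nat) ∈ pts .nat := by
      have : c = 0 ∨ c = 1 := by omega
      rcases this with rfl | rfl <;> simp [pts]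
    exact this
  | σ :: Γ => by
    obtain ⟨z, hz, h1, h2⟩ := exists_const_mem_pts K c hc Γ
    refine ⟨constTm σ z, constTm_mem_pts hz, fun γ => ?_, fun f => ?_⟩
    · simp only [sapps]
      exact (congrArg (fun F => sapps Γ F _) (constTm_den K z _)).trans (h1 _)
    · exact .of_step (Step.apps Γ _ (constTm_step z _)) (h2 _)

/-- Some function of the finite set tests the argument at a given position. -/
theorem exists_proj_mem_pts (K : ℕ) {σ : Ty} (h : Test σ) (hh : h ∈ tests σ) {Γ : Env}
    (x : Var Γ σ) :
    ∃ z ∈ pts (Ty.arrows Γ), (∀ γ, sapps Γ (z.den K Den.nil) γ = h.den K (γ σ x)) ∧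
      ∀ f : Subst Γ [], h.Pass (f σ x) → EvalsTo (Tm.apps Γ z f) 0 := by
  induction x with
  | @zero Γ σ =>
    refine ⟨firstTm (Ty.arrows Γ) h, firstTm_mem_pts hh, fun γ => ?_, fun f hf => ?_⟩
    · simp only [sapps]
      exact (congrArg (fun F => sapps Γ F _) (firstTm_den K h _)).trans (sapps_constFun K Γ _ _)
    · exact .of_step (Step.apps Γ _ (firstTm_step h _)) (constFun_evalsTo Γ _ _ 0 hf.evalsTo)
  | @succ Γ σ τ x ih =>
    obtain ⟨z, hz, h1, h2⟩ := ih h hh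
    refine ⟨constTm τ z, constTm_mem_pts hz, fun γ => ?_, fun f hf => ?_⟩
    · simp only [sapps]
      exact (congrArg (fun F => sapps Γ F _) (constTm_den K z _)).trans (h1 _)
    · exact .of_step (Step.apps Γ _ (constTm_step z _)) (h2 _ hf)

/-! ### Kripke logical relations over a predicate on programs -/

/-- Worlds with an environment each, in which values are provided by points of a common type. -/
structure Frame (Θ : Type) where
  /-- The worlds. -/
  W : Type
  /-- The environment of a world. -/
  ctx : W → Env
  /-- The values of the variables of a world at a point. -/
  pt : ∀ w, Θ → Den (ctx w)

namespace Frame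

variable {Θ : Type} (𝔉 : Frame Θ) (G : (Θ → Part ℕ) → Prop) (K : ℕ)

/-- The renamings between worlds that are compatible with the values. -/
def Hom {w w' : 𝔉.W} (f : Ren (𝔉.ctx w) (𝔉.ctx w')) : Prop :=
  ∀ (θ : Θ) (τ : Ty) (x : Var (𝔉.ctx w) τ), 𝔉.pt w' θ τ (f τ x) = 𝔉.pt w θ τ x

/-- The logical relation generated by `G` at the type of natural numbers. -/
def R : (σ : Ty) → (w : 𝔉.W) → Tm (𝔉.ctx w) σ → Prop
  | .nat, w, M => G fun θ => M.den K (𝔉.pt w θ)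
  -- The arguments are terms of a later world, not arbitrary elements of the model, because
  -- separation concerns definable tuples only.
  | .arr σ τ, w, M => ∀ (w' : 𝔉.W) (f : Ren (𝔉.ctx w) (𝔉.ctx w')), 𝔉.Hom f →
      ∀ N : Tm (𝔉.ctx w') σ, R σ w' N → R τ w' (.app (M.rename f) N)

variable {𝔉 G K}

theorem hom_id (w : 𝔉.W) : 𝔉.Hom (w := w) (w' := w) fun _ x => x := fun _ _ _ => rfl

theorem Hom.comp {w w' w'' : 𝔉.W} {f : Ren (𝔉.ctx w) (𝔉.ctx w')}
    {g : Ren (𝔉.ctx w') (𝔉.ctx w'')} (hf : 𝔉.Hom f) (hg : 𝔉.Hom g) :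
    𝔉.Hom (w := w) (w' := w'') fun τ x => g τ (f τ x) :=
  fun θ τ x => (hg θ τ _).trans (hf θ τ x)

theorem Hom.den_rename {w w' : 𝔉.W} {f : Ren (𝔉.ctx w) (𝔉.ctx w')} (hf : 𝔉.Hom f) {σ : Ty}
    (M : Tm (𝔉.ctx w) σ) (θ : Θ) : (M.rename f).den K (𝔉.pt w' θ) = M.den K (𝔉.pt w θ) := by
  rw [Tm.den_rename]
  congr 1
  funext τ x
  exact hf θ τ x

/-- Although it is a relation on terms, only their values at the points matter. Equalities of
denotations thus replace syntactic identities of substitutions below. -/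
theorem R_congr {σ : Ty} {w : 𝔉.W} {M M' : Tm (𝔉.ctx w) σ}
    (h : ∀ θ, M.den K (𝔉.pt w θ) = M'.den K (𝔉.pt w θ)) (hM : 𝔉.R G K σ w M) :
    𝔉.R G K σ w M' := by
  induction σ generalizing w with
  | nat =>
    have : (fun θ => M.den K (𝔉.pt w θ)) = fun θ => M'.den K (𝔉.pt w θ) := funext h
    unfold R at hM ⊢
    exact this ▸ hM
  | arr σ τ _ ih =>
    intro w' f hf N hN
    refine ih (fun θ => ?_) (hM w' f hf N hN)
    simp only [Tm.den, hf.den_rename, h]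

theorem R_rename {σ : Ty} {w w' : 𝔉.W} {M : Tm (𝔉.ctx w) σ} {f : Ren (𝔉.ctx w) (𝔉.ctx w')}
    (hf : 𝔉.Hom f) (hM : 𝔉.R G K σ w M) : 𝔉.R G K σ w' (M.rename f) := by
  cases σ with
  | nat =>
    have : (fun θ => M.den K (𝔉.pt w θ)) = fun θ => (M.rename f).den K (𝔉.pt w' θ) :=
      funext fun θ => (hf.den_rename M θ).symm
    unfold R at hM ⊢
    exact this ▸ hM
  | arr σ τ =>
    intro w'' g hg N hN
    refine R_congr (fun θ => ?_) (hM w'' _ (hf.comp hg) N hN)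
    simp only [Tm.den, hg.den_rename, hf.den_rename, (hf.comp hg).den_rename]

theorem R_app {σ τ : Ty} {w : 𝔉.W} {M : Tm (𝔉.ctx w) (.arr σ τ)} {N : Tm (𝔉.ctx w) σ}
    (hM : 𝔉.R G K (.arr σ τ) w M) (hN : 𝔉.R G K σ w N) : 𝔉.R G K τ w (.app M N) := by
  refine R_congr (fun θ => ?_) (hM w _ (hom_id w) N hN)
  simp only [Tm.den, (hom_id w).den_rename]

theorem R_apps : (Γ : Env) → {w : 𝔉.W} → {M : Tm (𝔉.ctx w) (Ty.arrows Γ)} →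
    {θ : Subst Γ (𝔉.ctx w)} → 𝔉.R G K (Ty.arrows Γ) w M → (∀ τ x, 𝔉.R G K τ w (θ τ x)) →
    𝔉.R G K .nat w (Tm.apps Γ M θ)
  | [], _, _, _, hM, _ => hM
  | σ :: Γ, _, _, _, hM, hθ =>
    R_apps Γ (R_app (σ := σ) (τ := Ty.arrows Γ) hM (hθ _ .zero)) fun τ x => hθ τ x.succ

/-- The extension of a substitution by a term for a new variable. -/
def _root_.PCF.Subst.cons {Γ Δ : Env} {σ : Ty} (N : Tm Δ σ) (θ : Subst Γ Δ) : Subst (σ :: Γ) Δ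
  | _, .zero => N
  | _, .succ x => θ _ x

theorem _root_.PCF.Subst.den_cons {Γ Δ : Env} {σ : Ty} (N : Tm Δ σ) (θ : Subst Γ Δ) (γ : Den Δ) :
    (fun τ x => (Subst.cons N θ τ x).den K γ) =
      Den.cons (N.den K γ) fun τ x => (θ τ x).den K γ := by
  funext τ x
  cases x <;> rfl

theorem R_arrows : (Γ : Env) → {w : 𝔉.W} → {M : Tm (𝔉.ctx w) (Ty.arrows Γ)} →
    (∀ (w' : 𝔉.W) (f : Ren (𝔉.ctx w) (𝔉.ctx w')), 𝔉.Hom f → ∀ θ : Subst Γ (𝔉.ctx w'),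
      (∀ τ x, 𝔉.R G K τ w' (θ τ x)) → 𝔉.R G K .nat w' (Tm.apps Γ (M.rename f) θ)) →
    𝔉.R G K (Ty.arrows Γ) w M
  | [], w, M, h => by
    refine R_congr (fun θ => ?_) (h w _ (hom_id w) (fun _ x => nomatch x) fun _ x => nomatch x)
    exact (hom_id w).den_rename M θ
  | σ :: Γ, w, M, h => by
    intro w' f hf N hN
    refine R_arrows Γ fun w'' g hg θ hθ => ?_
    refine R_congr (fun γ => ?_) (h w'' _ (hf.comp hg) (Subst.cons (N.rename g) θ) ?_)
    · have e : (M.rename fun τ x => g τ (f τ x)).den K (𝔉.pt w'' γ) =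
          ((M.rename f).rename g).den K (𝔉.pt w'' γ) := by
        rw [(hf.comp hg).den_rename, hg.den_rename, hf.den_rename]
      refine (Tm.den_apps K (σ :: Γ) _ _ _).trans (Eq.trans ?_ (Tm.den_apps K Γ _ _ _).symm)
      exact congrArg (fun F : D (.arr σ (Ty.arrows Γ)) =>
        sapps Γ ((show D σ → D (Ty.arrows Γ) from F) ((N.rename g).den K (𝔉.pt w'' γ)))
          fun τ x => (θ τ x).den K (𝔉.pt w'' γ)) e
    · intro τ x
      cases x with
      | zero => exact R_rename hg hN
      | succ x => exact hθ τ x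

/-- The closure properties of the base predicate. -/
structure Strict (G : (Θ → Part ℕ) → Prop) : Prop where
  const : ∀ v, G fun _ => v
  bind : ∀ (d : Θ → Part ℕ) (e : ℕ → Θ → Part ℕ), G d → (∀ n, G (e n)) →
    G fun θ => (d θ).bind fun n => e n θ

theorem R_bot (hG : Strict G) {σ : Ty} {w : 𝔉.W} {M : Tm (𝔉.ctx w) σ}
    (h : ∀ θ, M.den K (𝔉.pt w θ) = bot σ) : 𝔉.R G K σ w M := by
  induction σ generalizing w with
  | nat =>
    have : (fun θ => M.den K (𝔉.pt w θ)) = fun _ => bot .nat := funext h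
    unfold R
    exact this ▸ hG.const _
  | arr σ τ _ ih =>
    intro w' f hf N _
    refine ih fun θ => ?_
    simp only [Tm.den, hf.den_rename, h]
    rfl

/-- The bounded recursion operator is simulated by iterated application to a diverging term, so the
relation need not be closed under limits. -/
theorem exists_R_iterate (hG : Strict G) {σ : Ty} {w : 𝔉.W} {N : Tm (𝔉.ctx w) (.arr σ σ)}
    (hN : 𝔉.R G K (.arr σ σ) w N) (n : ℕ) :
    ∃ M, 𝔉.R G K σ w M ∧
      ∀ θ, M.den K (𝔉.pt w θ) = (show D σ → D σ from N.den K (𝔉.pt w θ))^[n] (bot σ) := by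
  induction n with
  | zero =>
    obtain ⟨z, -, hz⟩ := exists_bot_mem_pts K σ
    have h : ∀ θ, (z.weaken (𝔉.ctx w)).den K (𝔉.pt w θ) = bot σ :=
      fun θ => (Tm.den_weaken K z _).trans hz
    exact ⟨_, R_bot hG h, h⟩
  | succ n ih =>
    obtain ⟨M, hM, h⟩ := ih
    refine ⟨.app N M, R_app hN hM, fun θ => ?_⟩
    rw [Function.iterate_succ_apply', ← h]
    rfl

theorem R_nat_congr {w : 𝔉.W} {M : Tm (𝔉.ctx w) .nat} {d : Θ → Part ℕ}
    (h : ∀ θ, d θ = M.den K (𝔉.pt w θ)) (hd : G d) : 𝔉.R G K .nat w M := by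
  have : d = fun θ => M.den K (𝔉.pt w θ) := funext h
  unfold R
  exact this ▸ hd

/-- The fundamental lemma. -/
theorem R_subst (hG : Strict G) {Γ : Env} {σ : Ty} (M : Tm Γ σ) {w : 𝔉.W}
    {θ : Subst Γ (𝔉.ctx w)} (hθ : ∀ τ x, 𝔉.R G K τ w (θ τ x)) :
    𝔉.R G K σ w (M.subst θ) := by
  induction M generalizing w with
  | var x => exact hθ _ x
  | @lam Γ σ τ M ih =>
    intro w' f hf N hN
    refine R_congr (fun γ => ?_)
      (ih (w := w') (θ := Subst.cons N fun τ x => (θ τ x).rename f) ?_)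
    · rw [Tm.den_subst, Subst.den_cons]
      simp only [hf.den_rename]
      exact congrFun ((Tm.den_subst K (.lam M) θ _).symm.trans (hf.den_rename _ γ).symm)
        (N.den K (𝔉.pt w' γ))
    · intro υ x
      cases x with
      | zero => exact hN
      | succ x => exact R_rename hf (hθ υ x)
  | app M N ihM ihN => exact R_app (ihM hθ) (ihN hθ)
  | num n => exact hG.const _
  | suc =>
    intro w' f _ N hN
    exact hG.bind _ (fun n _ => Part.some (n + 1)) hN fun _ => hG.const _
  | pre =>
    intro w' f _ N hN
    exact hG.bind _ (fun n _ => Part.some (n - 1)) hN fun _ => hG.const _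
  | oracle g =>
    intro w' f _ N hN
    exact hG.bind _ (fun n _ => g n) hN fun _ => hG.const _
  | ifzero =>
    intro w₁ f₁ _ N₁ h₁ w₂ f₂ hf₂ N₂ h₂ w₃ f₃ hf₃ N₃ h₃
    refine R_nat_congr (d := fun γ => Part.bind (N₁.den K (𝔉.pt w₁ γ)) fun n =>
      if n = 0 then N₂.den K (𝔉.pt w₂ γ) else N₃.den K (𝔉.pt w₃ γ)) (fun γ => ?_) ?_
    · simp only [Tm.rename, Tm.subst, Tm.den, hf₃.den_rename, hf₂.den_rename]
    · refine hG.bind _ (fun n γ => if n = 0 then N₂.den K (𝔉.pt w₂ γ) else N₃.den K (𝔉.pt w₃ γ))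
        h₁ fun n => ?_
      cases n with
      | zero => exact h₂
      | succ n => exact h₃
  | fix σ =>
    intro w' f hf N hN
    obtain ⟨M, hM, h⟩ := exists_R_iterate hG hN K
    exact R_congr h hM

end Frame

/-! ### Sublevels and admissible environments -/

theorem Ty.sublevel_le_iff {σ : Ty} {j l : ℕ} :
    σ.sublevel ≤ toLex (j, l) ↔ σ.level < j ∨ σ.level = j ∧ σ.width ≤ l := by
  rw [Ty.sublevel, Prod.Lex.toLex_le_toLex]

/-- All the arguments of a type have sublevel at most `(j, l)`. -/
def Ty.ArgsLe (j l : ℕ) : Ty → Prop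
  | .nat => True
  | .arr σ τ => σ.sublevel ≤ toLex (j, l) ∧ τ.ArgsLe j l

theorem Ty.argsLe_of_sublevel_le {j l : ℕ} :
    {σ : Ty} → σ.sublevel ≤ toLex (j + 1, l) → σ.ArgsLe j l
  | .nat, _ => trivial
  | .arr σ τ, h => by
    simp only [Ty.sublevel_le_iff, Ty.level, Ty.width] at h
    refine ⟨Ty.sublevel_le_iff.2 (by omega), Ty.argsLe_of_sublevel_le (Ty.sublevel_le_iff.2 ?_)⟩
    omega

theorem Ty.sublevel_le_succ {σ : Ty} {j l : ℕ} (h : σ.sublevel ≤ toLex (j, l)) :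
    σ.sublevel ≤ toLex (j + 1, l) := by
  rw [Ty.sublevel_le_iff] at *
  omega

theorem Ty.arity_le_width : (σ : Ty) → σ.arity ≤ σ.width
  | .nat => le_rfl
  | .arr σ τ => by simp [Ty.arity, Ty.width]

theorem Ty.arity_le {σ : Ty} {l : ℕ} (h : σ.sublevel ≤ toLex (1, l)) : σ.arity ≤ l := by
  cases σ with
  | nat => exact Nat.zero_le l
  | arr σ τ =>
    have := (Ty.arr σ τ).arity_le_width
    rw [Ty.sublevel_le_iff] at h
    simp only [Ty.level] at h
    omega

/-- The environments whose types have sublevel at most `(j, l)`, with at most `l` variables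
if `j = 0`. -/
structure Env.Admissible (j l : ℕ) (Γ : Env) : Prop where
  sublevel_le : ∀ σ, Var Γ σ → σ.sublevel ≤ toLex (j, l)
  length_le : j = 0 → Γ.length ≤ l

/-- No tuple of terms in the variables of `Ξ` factors through the variables of an admissible
environment and passes all the tests that the points pass. -/
def Separated (K j l : ℕ) (Ξ : Env) : Prop :=
  ∀ Γ : Env, Γ.Admissible j l → ∀ (s : Subst Γ Ξ) (P : Subst Ξ Γ),
    ∃ f : Subst Ξ [], (∀ τ x, f τ x ∈ pts τ) ∧ ∃ (τ : Ty) (x : Var Ξ τ), ∃ h ∈ tests τ,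
      h.Pass (f τ x) ∧ h.den K ((P τ x).den K fun υ y =>
        (s υ y).den K fun _ x => (f _ x).den K Den.nil) ≠ Part.some 0

-- The inductive step: from separated arguments to their function space

section Separation

variable (K j l : ℕ) (Ξ : Env)

/-- The values of a functional variable and of its arguments for which the application
converges. -/
def goodPts : Set (Den (Ty.arrows Ξ :: Ξ)) :=
  {γ | ∃ z ∈ pts (Ty.arrows Ξ), ∃ f : Subst Ξ [], (∀ τ x, f τ x ∈ pts τ) ∧
    -- The finite sets of tests only ask for the results 0 and 1.
    (∃ c ≤ 1, EvalsTo (Tm.apps Ξ z f) c) ∧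
    γ = Den.cons (z.den K Den.nil) fun τ x => (f τ x).den K Den.nil}

/-- Programs that ignore their input or diverge at one of the distinguished points. -/
def ConstOrDiverges (d : Den (Ty.arrows Ξ :: Ξ) → Part ℕ) : Prop :=
  (∃ v, ∀ γ, d γ = v) ∨ ∃ γ ∈ goodPts K Ξ, d γ = Part.none

/-- A constant first stage either selects a single continuation or is undefined everywhere;
divergence of the first stage at a point persists. -/
theorem strict_constOrDiverges : Frame.Strict (ConstOrDiverges K Ξ) where
  const v := .inl ⟨v, fun _ => rfl⟩
  bind d e hd he := by
    rcases hd with ⟨v, hv⟩ | ⟨γ, hγ, h⟩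
    · obtain rfl : d = fun _ => v := funext hv
      by_cases hn : ∃ n, n ∈ v
      · obtain ⟨n, hn⟩ := hn
        simpa only [Part.eq_some_iff.2 hn, Part.bind_some] using he n
      · refine .inl ⟨Part.none, fun γ => ?_⟩
        have hv : v = Part.none := Part.eq_none_iff.2 fun n h => hn ⟨n, h⟩
        exact hv ▸ Part.bind_none _
    · exact .inr ⟨γ, hγ, (congrArg (fun a => Part.bind a fun n => e n γ) h).trans
        (Part.bind_none _)⟩

/-- The frame with a single world, which consists of a functional variable and its arguments. -/
def outerFrame : Frame (Den (Ty.arrows Ξ :: Ξ)) where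
  W := Unit
  ctx _ := Ty.arrows Ξ :: Ξ
  pt _ γ := γ

/-- An admissible environment with terms for its variables. -/
structure World where
  /-- The environment. -/
  env : Env
  /-- The terms for the variables. -/
  sub : Subst env (Ty.arrows Ξ :: Ξ)
  admissible : env.Admissible j l

variable {j l Ξ} in
/-- The terms for the variables of a world, including the functional variable. -/
def World.full (w : World j l Ξ) : Subst (Ty.arrows Ξ :: w.env) (Ty.arrows Ξ :: Ξ) :=
  Subst.cons (.var .zero) w.sub

/-- The frame of the admissible environments. -/
def innerFrame : Frame (Den (Ty.arrows Ξ :: Ξ)) where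
  W := World j l Ξ
  ctx w := Ty.arrows Ξ :: w.env
  pt w γ := fun τ x => (w.full τ x).den K γ

/-- The logical relation of the frame with a single world. -/
abbrev Outer (σ : Ty) (M : Tm (Ty.arrows Ξ :: Ξ) σ) : Prop :=
  (outerFrame Ξ).R (ConstOrDiverges K Ξ) K σ () M

variable {j l Ξ} in
/-- The logical relation of the frame of admissible environments. -/
abbrev Inner (σ : Ty) (w : World j l Ξ) (M : Tm (Ty.arrows Ξ :: w.env) σ) : Prop :=
  (innerFrame K j l Ξ).R (ConstOrDiverges K Ξ) K σ w M

variable {K j l Ξ}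

/-- The extension of a world by a term for a new variable. -/
def World.extend (w : World j l Ξ) {σ : Ty} (N : Tm (Ty.arrows Ξ :: Ξ) σ)
    (h : Env.Admissible j l (σ :: w.env)) : World j l Ξ :=
  ⟨σ :: w.env, Subst.cons N w.sub, h⟩

theorem World.hom_extend (w : World j l Ξ) {σ : Ty} (N : Tm (Ty.arrows Ξ :: Ξ) σ)
    (h : Env.Admissible j l (σ :: w.env)) :
    (innerFrame K j l Ξ).Hom (w := w) (w' := w.extend N h)
      (Ren.lift (fun _ => Var.succ) (Ty.arrows Ξ)) := by
  intro γ τ x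
  cases x <;> rfl

/-- The two directions are proved together by induction on the type. From inner to outer, an
argument is named by a fresh variable of an extended world, and the second direction shows that this
variable is related; for `j = 0` each argument uses up one of the `l` places. From outer to inner,
the first direction turns the argument into a related outer term. -/
theorem outer_inner : (σ : Ty) →
    (∀ (w : World j l Ξ) (M : Tm (Ty.arrows Ξ :: w.env) σ), σ.ArgsLe j l →
      (j = 0 → w.env.length + σ.arity ≤ l) → Inner K σ w M → Outer K Ξ σ (M.subst w.full)) ∧
    (∀ (w : World j l Ξ) (M : Tm (Ty.arrows Ξ :: w.env) σ), σ.sublevel ≤ toLex (j, l) →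
      Outer K Ξ σ (M.subst w.full) → Inner K σ w M)
  | .nat => by
    have key : ∀ (w : World j l Ξ) (M : Tm (Ty.arrows Ξ :: w.env) .nat) γ,
        (M.subst w.full).den K γ = M.den K ((innerFrame K j l Ξ).pt w γ) :=
      fun w M γ => Tm.den_subst K M w.full γ
    exact ⟨fun w M _ _ h => Frame.R_nat_congr (𝔉 := outerFrame Ξ) (fun γ => (key w M γ).symm) h,
      fun w M _ h => Frame.R_nat_congr (𝔉 := innerFrame K j l Ξ) (key w M) h⟩
  | .arr σ τ => by
    obtain ⟨ihσ, ihσ'⟩ := outer_inner σ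
    obtain ⟨ihτ, ihτ'⟩ := outer_inner τ
    constructor
    · intro w M hM hl h _ f hf N hN
      have adm : Env.Admissible j l (σ :: w.env) := by
        refine ⟨fun υ x => ?_, fun hj => ?_⟩
        · cases x with
          | zero => exact hM.1
          | succ x => exact w.admissible.sublevel_le υ x
        · have := hl hj
          simp only [Ty.arity, List.length_cons] at this ⊢
          omega
      have hx : Inner K σ (w.extend N adm) (.var (.succ .zero)) :=
        ihσ' (w.extend N adm) _ hM.1 hN
      have := ihτ (w.extend N adm) _ hM.2 (fun hj => ?_) (h _ _ (w.hom_extend N adm) _ hx)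
      · refine Frame.R_congr (𝔉 := outerFrame Ξ) (fun γ => ?_) this
        refine (Tm.den_subst K _ _ _).trans ?_
        refine (congrFun ((w.hom_extend N adm).den_rename M γ) (N.den K γ)).trans ?_
        refine (congrFun (Tm.den_subst K M w.full γ) (N.den K γ)).symm.trans ?_
        exact (congrFun (hf.den_rename (M.subst w.full) γ) (N.den K γ)).symm
      · have := hl hj
        simp only [Ty.arity, World.extend, List.length_cons] at this ⊢
        omega
    · intro w M hM h w' f hf N hN
      have hσ : (Ty.arr σ τ).ArgsLe j l := Ty.argsLe_of_sublevel_le (Ty.sublevel_le_succ hM)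
      rw [Ty.sublevel_le_iff] at hM
      simp only [Ty.level, Ty.width] at hM
      refine ihτ' w' _ (Ty.sublevel_le_iff.2 (by omega)) ?_
      have hN' := ihσ w' N (Ty.argsLe_of_sublevel_le (Ty.sublevel_le_succ hσ.1))
        (fun hj => by omega) hN
      refine Frame.R_congr (𝔉 := outerFrame Ξ) (fun γ => ?_)
        (Frame.R_app (𝔉 := outerFrame Ξ) h hN')
      refine Eq.trans ?_ (Tm.den_subst K (.app (M.rename f) N) w'.full γ).symm
      refine (congrFun (Tm.den_subst K M w.full γ) _).trans ?_
      refine (congrFun (hf.den_rename M γ).symm _).trans ?_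
      exact congrArg (show D σ → D τ from (M.rename f).den K _) (Tm.den_subst K N w'.full γ)

/-- An application of the functional variable diverges at a distinguished point. -/
theorem Separated.diverges (hS : Separated K j l Ξ) (w : World j l Ξ)
    (a : Subst Ξ (Ty.arrows Ξ :: w.env)) :
    ConstOrDiverges K Ξ fun γ =>
      (Tm.apps Ξ (.var .zero) a).den K ((innerFrame K j l Ξ).pt w γ) := by
  -- Separation speaks of terms without the functional variable, so the constant function 0 is
  -- substituted for it.
  obtain ⟨z₀, -, hz₀, -⟩ := exists_const_mem_pts K 0 zero_le_one Ξ
  obtain ⟨f, hf, τ, x, h, hh, hpass, hne⟩ := hS w.env w.admissible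
    (fun υ y => (w.sub υ y).subst (Subst.single (z₀.weaken Ξ)))
    (fun υ y => (a υ y).subst (Subst.single (z₀.weaken w.env)))
  -- The function `z₁` performs the separating test on its argument at `x`: it converges at `f`,
  -- which passes.
  obtain ⟨z₁, hz₁, hden, hev⟩ := exists_proj_mem_pts K h hh x
  refine .inr ⟨_, ⟨z₁, hz₁, f, hf, ⟨0, zero_le_one, hev f hpass⟩, rfl⟩, ?_⟩
  refine (Tm.den_apps K Ξ _ _ _).trans ((hden _).trans ?_)
  -- Since `z₁` lies below `z₀`, a test that fails with `z₀` in place of the variable also fails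
  -- with `z₁`.
  have hle : Le (Ty.arrows Ξ) (z₁.den K Den.nil) (z₀.den K Den.nil) := by
    refine le_of_sapps Ξ _ _ fun γ γ' _ => ?_
    rw [hden, hz₀]
    exact h.den_le K _
  have hf' : Den.Le (fun _ x => (f _ x).den K Den.nil : Den Ξ)
      (fun _ x => (f _ x).den K Den.nil) := fun υ y => (f υ y).den_self
  simp only [Tm.den_single, Tm.den_weaken] at hne
  have hpt : Den.Le
      ((innerFrame K j l Ξ).pt w
        (Den.cons (z₁.den K Den.nil) fun τ x => (f τ x).den K Den.nil))
      (Den.cons (z₀.den K Den.nil) fun υ y => (w.sub υ y).den K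
        (Den.cons (z₀.den K Den.nil) fun τ x => (f τ x).den K Den.nil)) := by
    intro υ y
    cases y with
    | zero => exact hle
    | succ y => exact (w.sub υ y).den_mono le_rfl (Den.Le.cons hle hf')
  have hmono := h.den_mono K ((a τ x).den_mono (K := K) le_rfl hpt)
  rw [h.den_eq_none hne] at hmono
  exact Part.eq_none_iff.2 fun m hm => Part.notMem_none m (hmono m hm)

/-- The functional variable belongs to the logical relation. -/
theorem Separated.inner_var (hS : Separated K j l Ξ) (w : World j l Ξ) :
    Inner K (Ty.arrows Ξ) w (.var .zero) := by
  refine Frame.R_arrows Ξ fun w' f hf θ _ => ?_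
  refine Frame.R_nat_congr (fun γ => ?_) (hS.diverges w' θ)
  refine (Tm.den_apps K Ξ _ _ _).trans (Eq.trans ?_ (Tm.den_apps K Ξ _ _ _).symm)
  exact congrArg (fun F => sapps Ξ F _) (hf γ _ .zero).symm

/-- The arguments of the functional variable belong to the logical relation. -/
theorem outer_var {τ : Ty} (x : Var Ξ τ) : Outer K Ξ τ (.var x.succ) := by
  obtain ⟨z, hz, -, hev⟩ := exists_const_mem_pts K 0 zero_le_one Ξ
  choose b hb hbot using exists_bot_mem_pts K
  -- A constant function converges even on undefined arguments, so this point is distinguished;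
  -- there each argument variable, applied to anything, is undefined.
  let γ₀ : Den (Ty.arrows Ξ :: Ξ) :=
    Den.cons (z.den K Den.nil) fun τ _ => (b τ).den K Den.nil
  have hγ₀ : γ₀ ∈ goodPts K Ξ :=
    ⟨z, hz, fun τ _ => b τ, fun τ _ => hb τ, ⟨0, zero_le_one, hev _⟩, rfl⟩
  have key : ∀ (σ : Ty) (M : Tm (Ty.arrows Ξ :: Ξ) σ), M.den K γ₀ = bot σ → Outer K Ξ σ M := by
    intro σ
    induction σ with
    | nat => exact fun M hM => .inr ⟨γ₀, hγ₀, hM⟩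
    | arr σ τ _ ih =>
      intro M hM _ f hf N _
      exact ih _ (congrFun ((hf.den_rename M γ₀).trans hM) _)
  exact key τ _ (hbot τ)

/-- If the arguments are separated from the admissible environments, then the function space is
separated from the types of the next sublevel. -/
theorem Separated.exists_fail (hS : Separated K j l Ξ) (σs : Env)
    (hσs : ∀ σ ∈ σs, σ.sublevel ≤ toLex (j + 1, l)) (t : Subst σs [Ty.arrows Ξ])
    (r : Tm σs (Ty.arrows Ξ)) :
    ∃ z ∈ pts (Ty.arrows Ξ), ∃ h ∈ tests (Ty.arrows Ξ), h.Pass z ∧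
      h.den K ((r.subst t).den K (Den.cons (z.den K Den.nil) Den.nil)) ≠ Part.some 0 := by
  by_contra! hcon
  -- The terms `t` start in the empty world, with the functional variable alone.
  let w₀ : World j l Ξ := ⟨[], fun _ x => (nomatch x), fun _ x => (nomatch x), fun _ => Nat.zero_le l⟩
  have mem : ∀ {Γ : Env} {σ : Ty}, Var Γ σ → σ ∈ Γ := by
    intro Γ σ x
    induction x with
    | zero => exact List.mem_cons_self
    | succ _ ih => exact List.mem_cons_of_mem _ ih
  have ht : ∀ σ (y : Var σs σ), Outer K Ξ σ ((t σ y).subst w₀.full) := by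
    intro σ y
    have hσ := hσs σ (mem y)
    refine (outer_inner σ).1 w₀ _ (Ty.argsLe_of_sublevel_le hσ) (fun hj => ?_) ?_
    · subst hj
      simpa [w₀] using Ty.arity_le hσ
    · have := Frame.R_subst (𝔉 := innerFrame K j l Ξ) (w := w₀) (K := K)
        (strict_constOrDiverges K Ξ) (t σ y) (θ := fun _ x => .var x) fun τ x => by
          cases x with
          | zero => exact hS.inner_var w₀
          | succ x => cases x
      have e : (t σ y).subst (fun _ x => .var x) = t σ y :=
        (Tm.subst_var _ fun _ x => x).trans (Tm.rename_id _ _ fun _ _ => rfl)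
      exact (congrArg (fun M => Inner K σ w₀ M) e).mp this
  have hr := Frame.R_apps (𝔉 := outerFrame Ξ) (K := K) Ξ (w := ())
    (Frame.R_subst (𝔉 := outerFrame Ξ) (w := ()) (K := K) (strict_constOrDiverges K Ξ) r ht)
    (θ := fun _ x => .var x.succ) fun _ x => outer_var x
  let d : Den (Ty.arrows Ξ :: Ξ) → Part ℕ := fun γ =>
    (Tm.apps Ξ (r.subst fun σ y => (t σ y).subst w₀.full) fun _ x => .var x.succ).den K γ
  have hval : ∀ (z : Closed (Ty.arrows Ξ)) (f : Subst Ξ []) (c : ℕ), c ≤ 1 → z ∈ pts _ →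
      (∀ τ x, f τ x ∈ pts τ) → EvalsTo (Tm.apps Ξ z f) c →
      c ∈ d (Den.cons (z.den K Den.nil) fun τ x => (f τ x).den K Den.nil) := by
    intro z f c hc hz hf hev
    have h0 := hcon z hz _ (ofArgs_mem_tests Ξ f hf c hc) ((Test.pass_ofArgs Ξ f c z).2 hev)
    rw [Test.den_ofArgs] at h0
    obtain ⟨n, hn, hn'⟩ := Part.mem_bind_iff.1 (Part.eq_some_iff.1 h0)
    have hnc : n = c := by
      unfold accept at hn'
      split_ifs at hn' with e
      · exact e
      · exact absurd hn' (Part.notMem_none _)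
    subst hnc
    refine (congrArg (fun a : Part ℕ => n ∈ a) (Eq.trans ?_ (Tm.den_apps K Ξ _ _ _).symm)).mp hn
    refine congrArg (fun F => sapps Ξ F fun τ x => (f τ x).den K Den.nil) ?_
    simp only [Tm.den_subst]
    congr 1
    funext σ y
    congr 1
    funext τ x
    cases x with
    | zero => rfl
    | succ x => cases x
  -- A constant program would have to return both 0 and 1; a divergent one contradicts `hval` at its
  -- point of divergence.
  rcases hr with ⟨v, hv⟩ | ⟨γ, ⟨z, hz, f, hf, ⟨c, hc, hev⟩, rfl⟩, hdiv⟩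
  · choose b hb _ using exists_bot_mem_pts K
    obtain ⟨z₀, hz₀, -, hev₀⟩ := exists_const_mem_pts K 0 zero_le_one Ξ
    obtain ⟨z₁, hz₁, -, hev₁⟩ := exists_const_mem_pts K 1 le_rfl Ξ
    have h₀ := hval z₀ (fun τ _ => b τ) 0 zero_le_one hz₀ (fun τ _ => hb τ) (hev₀ _)
    have h₁ := hval z₁ (fun τ _ => b τ) 1 le_rfl hz₁ (fun τ _ => hb τ) (hev₁ _)
    have e₀ : (0 : ℕ) ∈ v := (hv _) ▸ h₀
    have e₁ : (1 : ℕ) ∈ v := (hv _) ▸ h₁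
    exact zero_ne_one (Part.mem_unique e₀ e₁)
  · have := hval z f c hc hz hf hev
    exact Part.notMem_none c (hdiv ▸ this)

end Separation

/-! ### Powers of the type of natural numbers -/

/-- The tuple of the first `n` terms of a sequence. -/
def tuple {ρ : Ty} : (n : ℕ) → (ℕ → Closed ρ) → Subst (List.replicate n ρ) []
  | 0, _ => fun _ x => nomatch x
  | n + 1, g => Subst.cons (g 0) (tuple n fun i => g (i + 1))

theorem exists_var_tuple {ρ : Ty} : (n i : ℕ) → i < n →
    ∃ x : Var (List.replicate n ρ) ρ, ∀ g, tuple n g ρ x = g i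
  | 0, _, h => absurd h (Nat.not_lt_zero _)
  | _ + 1, 0, _ => ⟨.zero, fun _ => rfl⟩
  | n + 1, i + 1, h => by
    obtain ⟨x, hx⟩ := exists_var_tuple (ρ := ρ) n i (Nat.lt_of_succ_lt_succ h)
    exact ⟨.succ x, fun g => hx _⟩

theorem tuple_forall {ρ : Ty} {p : ∀ τ, Closed τ → Prop} :
    (n : ℕ) → (g : ℕ → Closed ρ) → (∀ i, p ρ (g i)) → ∀ τ x, p τ (tuple n g τ x)
  | _ + 1, _, h, _, .zero => h 0
  | n + 1, _, h, _, .succ x => tuple_forall n _ (fun i => h (i + 1)) _ x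

theorem tuple_le {ρ : Ty} (K : ℕ) : (n : ℕ) → (g g' : ℕ → Closed ρ) →
    (∀ i, Le ρ ((g i).den K Den.nil) ((g' i).den K Den.nil)) →
    Den.Le (fun τ x => (tuple n g τ x).den K Den.nil) fun τ x => (tuple n g' τ x).den K Den.nil
  | n + 1, _, _, h, _, .zero => h 0
  | n + 1, _, _, h, _, .succ x => tuple_le K n _ _ (fun i => h (i + 1)) _ x

open Classical in
/-- The number of defined entries of an environment. -/
noncomputable def rank : (Γ : Env) → Den Γ → ℕ
  | [], _ => 0
  | σ :: Γ, γ => (if γ σ .zero = bot σ then 0 else 1) + rank Γ fun τ x => γ τ x.succ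

theorem rank_le_length : (Γ : Env) → (γ : Den Γ) → rank Γ γ ≤ Γ.length
  | [], _ => le_rfl
  | σ :: Γ, γ => by
    have := rank_le_length Γ fun τ x => γ τ x.succ
    rw [rank, List.length_cons]
    split_ifs <;> omega

theorem eq_of_le_of_ne_bot {a a' : D .nat} (h : Le .nat a a') (ha : a ≠ bot .nat) : a = a' := by
  obtain ⟨n, hn⟩ : ∃ n, n ∈ (show Part ℕ from a) := by
    by_contra hcon
    exact ha (Part.eq_none_iff.2 fun n hn => hcon ⟨n, hn⟩)
  exact (Part.eq_some_iff.2 hn).trans (Part.eq_some_iff.2 (h n hn)).symm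

/-- The entries are flat, so an environment can only grow by acquiring defined entries. -/
theorem rank_mono : (Γ : Env) → (∀ σ, Var Γ σ → σ = .nat) → {γ γ' : Den Γ} → γ.Le γ' →
    rank Γ γ ≤ rank Γ γ' ∧ (rank Γ γ = rank Γ γ' → γ = γ')
  | [], _, γ, γ', _ => ⟨le_rfl, fun _ => (Den.eq_nil γ).trans (Den.eq_nil γ').symm⟩
  | σ :: Γ, hΓ, γ, γ', h => by
    obtain ⟨h1, h2⟩ := rank_mono Γ (fun τ x => hΓ τ x.succ) (γ := fun τ x => γ τ x.succ)
      (γ' := fun τ x => γ' τ x.succ) fun τ x => h τ x.succ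
    obtain rfl := hΓ σ .zero
    have h0 := h _ .zero
    have key : γ _ .zero = γ' _ .zero → rank Γ (fun τ x => γ τ x.succ) =
        rank Γ (fun τ x => γ' τ x.succ) → γ = γ' := by
      intro e e'
      rw [← Den.eta γ, ← Den.eta γ', e, h2 e']
    simp only [rank]
    by_cases hb : γ _ .zero = bot .nat
    · by_cases hb' : γ' _ .zero = bot .nat
      · rw [if_pos hb, if_pos hb']
        exact ⟨by omega, fun e => key (hb.trans hb'.symm) (by omega)⟩
      · rw [if_pos hb, if_neg hb']
        exact ⟨by omega, fun e => by omega⟩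
    · have e := eq_of_le_of_ne_bot h0 hb
      rw [if_neg hb, if_neg (e ▸ hb)]
      exact ⟨by omega, fun e' => key e (by omega)⟩

theorem Test.den_nat {K c : ℕ} {a : D .nat} (h : Test.den K (σ := .nat) c a = Part.some 0) :
    a = (Part.some c : Part ℕ) := by
  obtain ⟨n, hn, hn'⟩ := Part.mem_bind_iff.1
    (show 0 ∈ Part.bind (show Part ℕ from a) (accept c) from Part.eq_some_iff.1 h)
  unfold accept at hn'
  split_ifs at hn' with e
  · exact Part.eq_some_iff.2 (e ▸ hn)
  · exact absurd hn' (Part.notMem_none _)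

/-- If `l + 1` numbers could be recovered, filling them in one at a time would strictly increase the
intermediate environment `l + 1` times, but it has at most `l` entries. -/
theorem separated_nat (K l : ℕ) : Separated K 0 l (List.replicate (l + 1) .nat) := by
  intro Γ hΓ s P
  by_contra! hcon
  have hnat : ∀ σ, Var Γ σ → σ = .nat := by
    intro σ x
    have := Ty.sublevel_le_iff.1 (hΓ.sublevel_le σ x)
    cases σ with
    | nat => rfl
    | arr σ τ =>
      simp only [Ty.level] at this
      omega
  let V : (ℕ → Closed .nat) → Den Γ := fun g υ y =>
    (s υ y).den K fun τ x => (tuple (l + 1) g τ x).den K Den.nil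
  have hV : ∀ i < l + 1,
      ∃ x, ∀ g : ℕ → Closed .nat, (∀ i, g i ∈ pts .nat) → ∀ c ≤ 1, g i = .num c →
        (P .nat x).den K (V g) = (Part.some c : Part ℕ) := by
    intro i hi
    obtain ⟨x, hx⟩ := exists_var_tuple (ρ := .nat) (l + 1) i hi
    refine ⟨x, fun g hg c hc hgi => Test.den_nat (K := K) ?_⟩
    refine hcon _ (tuple_forall (p := fun τ M => M ∈ pts τ) (l + 1) g hg) .nat x c ?_ ?_
    · exact ofArgs_mem_tests [] (fun _ x => nomatch x) (fun _ x => nomatch x) c hc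
    · rw [hx, hgi]
      exact Relation.ReflTransGen.refl
  obtain ⟨b, hb, hbot⟩ := exists_bot_mem_pts K .nat
  have h0 : (Tm.num 0 : Closed .nat) ∈ pts .nat := by simp [pts]
  have h1 : (Tm.num 1 : Closed .nat) ∈ pts .nat := by simp [pts]
  let g : ℕ → ℕ → Closed .nat := fun i m => if m < i then .num 0 else b
  have hg : ∀ i m, g i m ∈ pts .nat := by
    intro i m
    simp only [g]
    split_ifs
    exacts [h0, hb]
  -- A second extension of `g i`, incompatible with `g (i + 1)` at position `i`.
  let g' : ℕ → ℕ → Closed .nat := fun i m => if m = i then .num 1 else g i m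
  have hg' : ∀ i m, g' i m ∈ pts .nat := by
    intro i m
    simp only [g']
    split_ifs
    exacts [h1, hg i m]
  have mono : ∀ g₁ g₂ : ℕ → Closed .nat, (∀ m, g₁ m = b ∨ g₁ m = g₂ m) → (V g₁).Le (V g₂) := by
    intro g₁ g₂ h υ y
    refine (s υ y).den_mono le_rfl (tuple_le K _ _ _ fun m => ?_)
    rcases h m with h | h
    · rw [h, hbot]
      exact bot_le _ _
    · rw [h]
      exact Tm.den_self _
  have hrank : ∀ i ≤ l + 1, i ≤ rank Γ (V (g i)) := by
    intro i
    induction i with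
    | zero => exact fun _ => Nat.zero_le _
    | succ i ih =>
      intro hi
      have hle : (V (g i)).Le (V (g (i + 1))) := mono _ _ fun m => by
        simp only [g]
        split_ifs <;> first | exact .inr rfl | exact .inl rfl | omega
      have hle' : (V (g i)).Le (V (g' i)) := mono _ _ fun m => by
        simp only [g', g]
        split_ifs <;> first | exact .inr rfl | exact .inl rfl | omega
      -- Otherwise the value 0 recovered at position `i` would already be obtained from `g i`, and
      -- by monotonicity also from `g' i`, where it is 1.
      have hne : V (g i) ≠ V (g (i + 1)) := by
        intro e
        obtain ⟨x, hx⟩ := hV i hi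
        have e0 := hx (g (i + 1)) (hg _) 0 zero_le_one (if_pos (Nat.lt_succ_self i))
        have e1 := hx (g' i) (hg' _) 1 le_rfl (if_pos rfl)
        have hle := (P .nat x).den_mono (K := K) le_rfl hle'
        rw [e, e0, e1] at hle
        exact zero_ne_one (Part.mem_some_iff.1 (hle 0 (Part.mem_some 0)))
      have := rank_mono Γ hnat hle
      have := ih (by omega)
      have : rank Γ (V (g i)) ≠ rank Γ (V (g (i + 1))) := fun e => hne ((rank_mono Γ hnat hle).2 e)
      omega
  have := hrank (l + 1) le_rfl
  have := rank_le_length Γ (V (g (l + 1)))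
  have := hΓ.length_le rfl
  omega

/-! ### Homogeneous types -/

/-- The identification of all the variables of an environment with a single type. -/
def collapse (ρ : Ty) : (n : ℕ) → Ren (List.replicate n ρ) [ρ]
  | _ + 1, _, .zero => .zero
  | n + 1, _, .succ x => collapse ρ n _ x

theorem Var.nonempty_of_mem {σ : Ty} : {Γ : Env} → σ ∈ Γ → Nonempty (Var Γ σ)
  | τ :: Γ, h => by
    rcases List.mem_cons.1 h with rfl | h
    · exact ⟨.zero⟩
    · exact (Var.nonempty_of_mem h).map .succ

/-- Already the diagonal tuples, with one point in all places, separate: recovering a single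
component from them would contradict `Separated.exists_fail`. -/
theorem Separated.replicate {K j l : ℕ} {Ξ : Env} (h : Separated K j l Ξ) (n : ℕ) :
    Separated K (j + 1) l (List.replicate (n + 1) (Ty.arrows Ξ)) := by
  intro Γ hΓ s P
  obtain ⟨z, hz, t, ht, hpass, hne⟩ := h.exists_fail Γ
    (fun σ hσ => (Var.nonempty_of_mem hσ).elim (hΓ.sublevel_le σ))
    (fun υ y => (s υ y).rename (collapse _ (n + 1))) (P _ .zero)
  have hmem : ∀ τ (y : Var [Ty.arrows Ξ] τ), Subst.single z τ y ∈ pts τ := by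
    intro τ y
    cases y with
    | zero => exact hz
    | succ y => cases y
  have hden : ∀ τ (y : Var [Ty.arrows Ξ] τ), (Subst.single z τ y).den K Den.nil =
      Den.cons (z.den K Den.nil) Den.nil τ y := by
    intro τ y
    cases y with
    | zero => rfl
    | succ y => cases y
  refine ⟨fun τ x => Subst.single z τ (collapse _ (n + 1) τ x), fun τ x => hmem τ _, _, .zero, t,
    ht, hpass, ?_⟩
  simp only [Tm.den_subst, Tm.den_rename] at hne
  simp only [hden]
  exact hne

theorem separated_rho (K j l : ℕ) :
    Separated K j l (List.replicate (l + 1) (Ty.rho j (l + 1))) := by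
  induction j with
  | zero => exact separated_nat K l
  | succ j ih => exact ih.replicate l

/-- The pair `(z, h)` is itself a test for functions, passed by the identity, hence by every
function that dominates the identity. -/
theorem PseudoRetract.exists_den {ρ : Ty} {σs : List Ty} {t : Subst σs [ρ]} {r : Tm σs ρ}
    (hd : Dominates (r.subst t) (.var .zero)) (z : Closed ρ) (h : Test ρ) (hz : h.Pass z) :
    ∃ K₀, ∀ K, K₀ ≤ K →
      h.den K ((r.subst t).den K (Den.cons (z.den K Den.nil) Den.nil)) = Part.some 0 := by
  let p : Test (.arr ρ ρ) := (z, h)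
  have hid : p.Pass (.lam (.var .zero)) := h.pass_of_step (Step.beta (.var .zero) z) hz
  have hev : EvalsTo (.app p.term (.lam (r.subst t))) 0 := hd (SF.mk p.term) 0 hid.evalsTo
  obtain ⟨K₀, hK₀⟩ := hev.exists_den
  exact ⟨K₀, fun K hK => (Test.den_arr K z h _).symm.trans (hK₀ K hK)⟩

end PCF

theorem theorem6p3 (k l : ℕ) (hk : 1 ≤ k) (σs : List PCF.Ty)
    (hσs : ∀ σ ∈ σs, σ.sublevel ≤ toLex (k, l)) :
    ¬ PCF.PseudoRetract (PCF.Ty.rho k (l + 1)) σs := by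
  obtain ⟨j, rfl⟩ : ∃ j, k = j + 1 := ⟨k - 1, by omega⟩
  rintro ⟨t, r, hd⟩
  have hex : ∀ p : PCF.Closed (PCF.Ty.rho (j + 1) (l + 1)) × PCF.Test (PCF.Ty.rho (j + 1) (l + 1)),
      ∃ K₀, p.2.Pass p.1 → ∀ K, K₀ ≤ K → p.2.den K ((r.subst t).den K
        (PCF.Den.cons (p.1.den K PCF.Den.nil) PCF.Den.nil)) = Part.some 0 := by
    rintro ⟨z, h⟩
    by_cases hz : h.Pass z
    · obtain ⟨K₀, hK₀⟩ := PCF.PseudoRetract.exists_den hd z h hz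
      exact ⟨K₀, fun _ => hK₀⟩
    · exact ⟨0, fun hz' => absurd hz' hz⟩
  choose K₀ hK₀ using hex
  have hfin := PCF.finite_pts_tests (PCF.Ty.rho (j + 1) (l + 1))
  -- The bound is fixed before separation supplies the point and the test that depend on it.
  obtain ⟨K, hK⟩ := ((hfin.1.prod hfin.2).image K₀).bddAbove
  obtain ⟨z, hz, h, hh, hpass, hne⟩ := (PCF.separated_rho K j l).exists_fail σs hσs t r
  exact hne (hK₀ (z, h) hpass K (hK ⟨(z, h), ⟨hz, hh⟩, rfl⟩))
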